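/- Let $k\ge 3$ be an integer and let $F$ be a finite simple graph with chromatic number $\chi(F)=k+1$. For a finite simple graph $G$, let $q(G)$ denote the largest eigenvalue of its signless Laplacian matrix $Q(G)=D(G)+A(G)$, where $D(G)$ is the diagonal matrix of vertex degrees and $A(G)$ is the adjacency matrix. Let $T_{n,k}$ denote the Turán graph, i.e. the complete $k$-partite graph on $n$ vertices whose part sizes are as equal as possible. For every $\varepsilon>0$ there exist $\sigma>0$ and $n_0$ such that if $G$ is a graph on $n\ge n_0$ vertices that contains no (not necessarily induced) subgraph isomorphic to $F$ and satisfies $$q(G)\ \ge\ 2\left(1-\frac1k-\sigma\right)n,$$ then $G$ can be obtained from a copy of $T_{n,k}$ on the vertex set of $G$ by adding and deleting at most $\varepsilon n^2$ edges in total. -/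

import Mathlib

namespace SimpleGraph

section SignlessLaplacian

variable {V : Type*} [Fintype V] [DecidableEq V] (G : SimpleGraph V) [DecidableRel G.Adj]

/-- The signless Laplacian matrix `Q(G) = D(G) + A(G)`. -/
def signlessLapMatrix : Matrix V V ℝ := G.degMatrix ℝ + G.adjMatrix ℝ

theorem isHermitian_signlessLapMatrix : G.signlessLapMatrix.IsHermitian :=
  (G.isHermitian_degMatrix ℝ).add (G.isHermitian_adjMatrix ℝ)

/-- The signless Laplacian spectral radius (`Q`-index) `q(G)`: the largest eigenvalue of `Q(G)`.
The supremum is over the finite family of all eigenvalues, so it is a maximum as soon as `G` has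
a vertex. -/
noncomputable def qIndex : ℝ := ⨆ v, G.isHermitian_signlessLapMatrix.eigenvalues v

end SignlessLaplacian

/-- `G` can be obtained from (a copy of) `H` by adding and deleting at most `m` edges: some graph
`H'` on the vertex set of `G` is isomorphic to `H`, and at most `m` pairs of vertices are an edge of
exactly one of `G` and `H'`. Meant for graphs on finitely many vertices. -/
def ObtainedByEdits {V W : Type*} (G : SimpleGraph V) (H : SimpleGraph W) (m : ℝ) : Prop :=
  ∃ H' : SimpleGraph V, Nonempty (H' ≃g H) ∧
    ((symmDiff G.edgeSet H'.edgeSet).ncard : ℝ) ≤ m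

end SimpleGraph

namespace SimpleGraph

open Finset

universe u

/-! A `k+1`-colourable `F` lies in the complete equipartite graph `K` with `k+1` parts of some fixed
size `s`, so every `F`-free graph is `K`-free. Write `c = 1 - 1/k`. The argument turns a large
`Q`-index into many edges and then applies edge stability for `K`-free graphs.

From `q` to edges: take a nonnegative unit vector maximizing the signless Laplacian form. If all its
squared entries are at least about `1/n`, then `q` is essentially at most twice the average degree
(`le_pairCount_of_le_sq`). Otherwise, deleting a vertex with the smallest entry raises `q/n` by
order `1/n` (`isQLower_comap_of_isMin`, `increment_le`). Iterating over a positive fraction of the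
vertices gives either a subgraph that is dense enough or a constant gain in `q/n`
(`exists_isContained_dense_or_increment`). The gain cannot persist, because `q/n` is asymptotically
at most `2c` on `K`-free graphs; this bound follows from Erdős–Stone by the same dichotomy
(`HasDensityBound.hasQBound`). Near-maximal `q` therefore forces near-maximal edge density
(`HasDensityBound.exists_le_pairCount`).

Stability: a nearly extremal graph contains a large complete `k`-partite graph on vertices of high
degree. Almost every vertex misses almost all of one part and little of the others, and this sorts
the vertices into `k` classes. A large complete bipartite graph inside a class would extend to `K`,
so the classes span few edges (`exists_partition_few_inner`). Counting then makes the classes nearly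
equal and nearly completely joined. -/

/-- The adjacency indicator of a graph, as a real number. -/
noncomputable def adjInd {V : Type*} (G : SimpleGraph V) (u v : V) : ℝ :=
  open Classical in if G.Adj u v then 1 else 0

/-- The number of ordered pairs of adjacent vertices, as a real number. -/
noncomputable def pairCount {V : Type*} [Fintype V] (G : SimpleGraph V) : ℝ :=
  ∑ u, ∑ v, G.adjInd u v

/-! ### Adjacency sums, subgraphs and vertex deletion. -/

section Basic

variable {V : Type*} (G : SimpleGraph V)

theorem adjInd_comm (u v : V) : G.adjInd u v = G.adjInd v u := by
  unfold adjInd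
  congr 1
  exact propext (G.adj_comm u v)

@[simp] theorem adjInd_self (u : V) : G.adjInd u u = 0 := by simp [adjInd]

theorem adjInd_nonneg (u v : V) : 0 ≤ G.adjInd u v := by
  unfold adjInd; split_ifs <;> norm_num

theorem adjInd_le_one (u v : V) : G.adjInd u v ≤ 1 := by
  unfold adjInd; split_ifs <;> norm_num

theorem adjInd_of_adj {u v : V} (h : G.Adj u v) : G.adjInd u v = 1 := by simp [adjInd, h]

theorem adjInd_of_not_adj {u v : V} (h : ¬ G.Adj u v) : G.adjInd u v = 0 := by simp [adjInd, h]

theorem adjInd_mono {V' : Type*} {G' : SimpleGraph V'} (f : G' →g G) (u v : V') :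
    G'.adjInd u v ≤ G.adjInd (f u) (f v) := by
  by_cases h : G'.Adj u v
  · rw [adjInd_of_adj _ h, adjInd_of_adj _ (f.map_adj h)]
  · rw [adjInd_of_not_adj _ h]; exact adjInd_nonneg _ _ _

theorem sum_adjInd_eq_degree [Fintype V] [DecidableRel G.Adj] (u : V) :
    ∑ v, G.adjInd u v = G.degree u := by
  classical
  rw [degree, neighborFinset_eq_filter, ← Finset.sum_boole]
  refine sum_congr rfl fun v _ ↦ ?_
  unfold adjInd
  congr

theorem sum_adjInd_le_card [Fintype V] (u : V) : ∑ v, G.adjInd u v ≤ Fintype.card V := by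
  calc ∑ v, G.adjInd u v ≤ ∑ _v : V, (1 : ℝ) := sum_le_sum fun v _ ↦ G.adjInd_le_one u v
    _ = Fintype.card V := by simp

theorem sum_adjInd_nonneg [Fintype V] (u : V) : 0 ≤ ∑ v, G.adjInd u v :=
  sum_nonneg fun v _ ↦ G.adjInd_nonneg u v

theorem pairCount_le_sq [Fintype V] : G.pairCount ≤ (Fintype.card V : ℝ) ^ 2 := by
  calc G.pairCount ≤ ∑ _u : V, (Fintype.card V : ℝ) := sum_le_sum fun u _ ↦ G.sum_adjInd_le_card u
    _ = (Fintype.card V : ℝ) ^ 2 := by simp [sq]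

theorem pairCount_mono {V' : Type*} [Fintype V] [Fintype V'] {G : SimpleGraph V}
    {G' : SimpleGraph V'} (h : G' ⊑ G) : G'.pairCount ≤ G.pairCount := by
  classical
  obtain ⟨f⟩ := h
  have key (g : V → ℝ) (hg : ∀ v, 0 ≤ g v) : ∑ v, g (f v) ≤ ∑ v, g v := by
    rw [← Finset.sum_image (f := g) (s := univ) (g := f) (fun a _ b _ hab ↦ f.injective hab)]
    exact sum_le_sum_of_subset_of_nonneg (subset_univ _) fun v _ _ ↦ hg v
  calc G'.pairCount ≤ ∑ u, ∑ v, G.adjInd (f u) (f v) :=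
        sum_le_sum fun u _ ↦ sum_le_sum fun v _ ↦ adjInd_mono G f.toHom u v
    _ ≤ ∑ u, ∑ v, G.adjInd (f u) v := sum_le_sum fun u _ ↦ key _ fun v ↦ G.adjInd_nonneg _ v
    _ ≤ G.pairCount := key (fun u ↦ ∑ v, G.adjInd u v) fun u ↦ G.sum_adjInd_nonneg u

/-- Splitting off one vertex from a symmetric double sum vanishing on the diagonal. -/
theorem sum_sum_eq_add_sum_sum_subtype_ne [Fintype V] [DecidableEq V] (v : V) (g : V → V → ℝ)
    (hs : ∀ u w, g u w = g w u) (h0 : g v v = 0) :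
    ∑ u, ∑ w, g u w = 2 * ∑ w, g v w + ∑ u : {u // u ≠ v}, ∑ w : {w // w ≠ v}, g u w := by
  have h1 (u : V) := Fintype.sum_eq_add_sum_subtype_ne (g u) v
  rw [Fintype.sum_eq_add_sum_subtype_ne _ v]
  have h2 : ∑ u : {u // u ≠ v}, ∑ w, g u w
      = ∑ u : {u // u ≠ v}, g u v + ∑ u : {u // u ≠ v}, ∑ w : {w // w ≠ v}, g u w := by
    rw [← sum_add_distrib]; exact sum_congr rfl fun u _ ↦ h1 u
  rw [h2, h1 v, h0]
  have h3 : ∑ u : {u // u ≠ v}, g u v = ∑ u : {u // u ≠ v}, g v u :=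
    sum_congr rfl fun u _ ↦ hs _ _
  rw [h3]; ring

theorem pairCount_eq_add_pairCount_induce [Fintype V] [DecidableEq V] (v : V) :
    G.pairCount = 2 * ∑ w, G.adjInd v w + (G.comap (Subtype.val : {u // u ≠ v} → V)).pairCount :=
  sum_sum_eq_add_sum_sum_subtype_ne v G.adjInd G.adjInd_comm (G.adjInd_self v)

theorem comap_val_isContained (p : V → Prop) : G.comap (Subtype.val : {u // p u} → V) ⊑ G :=
  ⟨⟨⟨Subtype.val, fun h ↦ h⟩, Subtype.val_injective⟩⟩

theorem card_subtype_ne [Fintype V] [DecidableEq V] (v : V) :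
    Fintype.card {u // u ≠ v} = Fintype.card V - 1 := by
  simp

end Basic

/-! ### Erdős–Stone: from minimum degree to edge count. -/

/-- A minimum degree condition forces a complete equipartite graph, over arbitrary finite types. -/
theorem exists_completeEquipartiteGraph_isContained_of_le_degree {ε : ℝ} (hε : 0 < ε) (r t : ℕ) :
    ∃ N : ℕ, ∀ (V : Type u) [Fintype V] (G : SimpleGraph V), N ≤ Fintype.card V →
      (∀ v, (1 - 1 / (r : ℝ) + ε) * Fintype.card V ≤ ∑ u, G.adjInd v u) →
      completeEquipartiteGraph (r + 1) t ⊑ G := by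
  classical
  obtain ⟨N, hN⟩ := Filter.eventually_atTop.mp
    (eventually_completeEquipartiteGraph_isContained_of_minDegree hε r t)
  refine ⟨max N 1, fun V _ G hV hdeg ↦ ?_⟩
  have : Nonempty V := Fintype.card_pos_iff.mp (lt_of_lt_of_le one_pos (le_of_max_le_right hV))
  have iso := G.overFinIso (rfl : Fintype.card V = Fintype.card V)
  rw [isContained_congr Iso.refl iso]
  refine hN _ (le_of_max_le_left hV) ?_
  rw [← iso.minDegree_eq]
  obtain ⟨v, hv⟩ := G.exists_minimal_degree_vertex
  rw [hv, ← sum_adjInd_eq_degree]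
  exact hdeg v

/-- The **Erdős–Stone theorem** (edge version), as an upper bound with an additive constant. -/
theorem exists_pairCount_le_of_free {ε : ℝ} (hε : 0 < ε) {r : ℕ} (hr : 0 < r) (t : ℕ) :
    ∃ C : ℝ, ∀ (V : Type u) [Fintype V] (G : SimpleGraph V),
      (completeEquipartiteGraph (r + 1) t).Free G →
      G.pairCount ≤ (1 - 1 / (r : ℝ) + ε) * (Fintype.card V * (Fintype.card V + 1)) + C := by
  classical
  obtain ⟨N, hN⟩ := exists_completeEquipartiteGraph_isContained_of_le_degree.{u} hε r t
  have hc : 0 ≤ 1 - 1 / (r : ℝ) + ε := by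
    have : 1 / (r : ℝ) ≤ 1 := by
      rw [div_le_one (by positivity)]; exact_mod_cast hr
    linarith
  refine ⟨(N : ℝ) ^ 2, ?_⟩
  -- Passing from order `n` to `n + 1` raises `n * (n + 1)` by `2 * (n + 1)`, exactly what pays for
  -- both orientations of the edges at a deleted low-degree vertex. The term `N ^ 2` covers orders
  -- below `N`.
  suffices h : ∀ n : ℕ, ∀ (V : Type u) [Fintype V] (G : SimpleGraph V), Fintype.card V = n →
      (completeEquipartiteGraph (r + 1) t).Free G →
      G.pairCount ≤ (1 - 1 / (r : ℝ) + ε) * (n * (n + 1)) + (N : ℝ) ^ 2 from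
    fun V _ G hG ↦ h _ V G rfl hG
  intro n
  induction n with
  | zero =>
    intro V _ G hV _
    have := G.pairCount_le_sq
    rw [hV] at this
    norm_num at this ⊢
    nlinarith [sq_nonneg (N : ℝ)]
  | succ n ih =>
    intro V _ G hV hG
    by_cases hn : N ≤ n + 1
    · have : ¬ ∀ v, (1 - 1 / (r : ℝ) + ε) * Fintype.card V ≤ ∑ u, G.adjInd v u :=
        fun h ↦ hG (hN V G (hV ▸ hn) h)
      push Not at this
      obtain ⟨v, hv⟩ := this
      have h1 := ih {u // u ≠ v} (G.comap Subtype.val) (by rw [card_subtype_ne, hV]; rfl)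
        fun h ↦ hG (h.trans (G.comap_val_isContained _))
      rw [G.pairCount_eq_add_pairCount_induce v]
      rw [hV] at hv
      push_cast at hv ⊢
      nlinarith
    · have h1 := G.pairCount_le_sq
      rw [hV] at h1
      have h2 : ((n + 1 : ℕ) : ℝ) ≤ N := by exact_mod_cast (not_le.mp hn).le
      have h3 : ((n + 1 : ℕ) : ℝ) ^ 2 ≤ (N : ℝ) ^ 2 := by gcongr
      have h4 : 0 ≤ (1 - 1 / (r : ℝ) + ε) * (((n + 1 : ℕ) : ℝ) * (((n + 1 : ℕ) : ℝ) + 1)) := by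
        positivity
      linarith

/-- The **Erdős–Stone theorem** (edge version). -/
theorem exists_pairCount_le_sq_of_free {ε : ℝ} (hε : 0 < ε) {r : ℕ} (hr : 0 < r) (t : ℕ) :
    ∃ N : ℕ, ∀ (V : Type u) [Fintype V] (G : SimpleGraph V), N ≤ Fintype.card V →
      (completeEquipartiteGraph (r + 1) t).Free G →
      G.pairCount ≤ (1 - 1 / (r : ℝ) + ε) * (Fintype.card V : ℝ) ^ 2 := by
  obtain ⟨C, hC⟩ := exists_pairCount_le_of_free.{u} (half_pos hε) hr t
  have hr' : 0 < (r : ℝ) := by exact_mod_cast hr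
  obtain ⟨N, hN⟩ := exists_nat_ge ((1 - 1 / (r : ℝ) + ε / 2 + |C|) / (ε / 2))
  refine ⟨max N 1, fun V _ G hV hG ↦ (hC V G hG).trans ?_⟩
  have h1 : (1 : ℝ) ≤ Fintype.card V := by exact_mod_cast le_of_max_le_right hV
  have h2 : (N : ℝ) ≤ Fintype.card V := by exact_mod_cast le_of_max_le_left hV
  rw [div_le_iff₀ (half_pos hε)] at hN
  have h3 := le_abs_self C
  have h4 : |C| ≤ |C| * Fintype.card V := le_mul_of_one_le_right (abs_nonneg C) h1
  have h5 : (1 - 1 / (r : ℝ) + ε / 2 + |C|) * Fintype.card V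
      ≤ (Fintype.card V * (ε / 2)) * Fintype.card V := by
    gcongr; exact hN.trans (by gcongr)
  nlinarith

/-! ### The signless Laplacian form and its maximizers. -/

/-- Twice the quadratic form of the signless Laplacian. -/
noncomputable def qForm {V : Type*} [Fintype V] (G : SimpleGraph V) (x : V → ℝ) : ℝ :=
  ∑ u, ∑ v, G.adjInd u v * (x u + x v) ^ 2

/-- Some unit vector has Rayleigh quotient at least `q` for the signless Laplacian. -/
def IsQLower {V : Type*} [Fintype V] (G : SimpleGraph V) (q : ℝ) : Prop :=
  ∃ x : V → ℝ, ∑ v, x v ^ 2 = 1 ∧ 2 * q ≤ G.qForm x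

section Spectral

variable {V : Type*} [Fintype V] (G : SimpleGraph V)

theorem qForm_eq (x : V → ℝ) :
    G.qForm x = 2 * ∑ u, x u * ∑ v, G.adjInd u v * (x u + x v) := by
  have h : G.qForm x = ∑ u, ∑ v, G.adjInd u v * (x u * (x u + x v))
      + ∑ u, ∑ v, G.adjInd u v * (x v * (x u + x v)) := by
    rw [← sum_add_distrib]
    refine sum_congr rfl fun u _ ↦ ?_
    rw [← sum_add_distrib]
    exact sum_congr rfl fun v _ ↦ by ring
  have h2 : ∑ u, ∑ v, G.adjInd u v * (x v * (x u + x v))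
      = ∑ u, ∑ v, G.adjInd u v * (x u * (x u + x v)) := by
    rw [sum_comm]
    refine sum_congr rfl fun u _ ↦ sum_congr rfl fun v _ ↦ ?_
    rw [adjInd_comm]; ring
  rw [h, h2, ← two_mul]
  congr 1
  refine sum_congr rfl fun u _ ↦ ?_
  rw [mul_sum]
  exact sum_congr rfl fun v _ ↦ by ring

theorem isQLower_qIndex [DecidableEq V] [DecidableRel G.Adj] [Nonempty V] :
    G.IsQLower G.qIndex := by
  set hA := G.isHermitian_signlessLapMatrix
  obtain ⟨i, hi⟩ := exists_eq_ciSup_of_finite (f := hA.eigenvalues)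
  have hq : G.qIndex = hA.eigenvalues i := hi.symm
  have hmul := hA.mulVec_eigenvectorBasis i
  set x : EuclideanSpace ℝ V := hA.eigenvectorBasis i
  have hnorm : ∑ v, x v ^ 2 = 1 := by
    have := EuclideanSpace.real_norm_sq_eq x
    rw [hA.eigenvectorBasis.orthonormal.1 i] at this
    rw [← this]; norm_num
  refine ⟨fun v ↦ x v, hnorm, ?_⟩
  rw [qForm_eq, hq]
  have hrow (u : V) : ∑ v, G.adjInd u v * (x u + x v) = hA.eigenvalues i * x u := by
    have h := congrFun hmul u
    simp only [signlessLapMatrix, Matrix.add_mulVec, Pi.add_apply, degMatrix_mulVec_apply,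
      Pi.smul_apply, smul_eq_mul] at h
    refine Eq.trans ?_ h
    rw [← sum_adjInd_eq_degree, sum_mul, Matrix.mulVec, dotProduct, ← sum_add_distrib]
    refine sum_congr rfl fun v _ ↦ ?_
    have : G.adjMatrix ℝ u v = G.adjInd u v := by
      rw [adjMatrix_apply]; unfold adjInd; congr
    rw [this]; ring
  simp only [hrow]
  have : ∑ u, x u * (hA.eigenvalues i * x u) = hA.eigenvalues i := by
    calc _ = hA.eigenvalues i * ∑ u, x u ^ 2 := by
            rw [mul_sum]; exact sum_congr rfl fun u _ ↦ by ring
      _ = _ := by rw [hnorm, mul_one]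
  rw [this]

theorem qForm_smul (t : ℝ) (x : V → ℝ) : G.qForm (fun v ↦ t * x v) = t ^ 2 * G.qForm x := by
  simp only [qForm, mul_sum]
  exact sum_congr rfl fun u _ ↦ sum_congr rfl fun v _ ↦ by ring

theorem qForm_le_four_mul_sum (x : V → ℝ) :
    G.qForm x ≤ 4 * ∑ u, (∑ v, G.adjInd u v) * x u ^ 2 := by
  have h2 : ∑ u, ∑ v, G.adjInd u v * x v ^ 2 = ∑ u, (∑ v, G.adjInd u v) * x u ^ 2 := by
    rw [sum_comm]
    refine sum_congr rfl fun u _ ↦ ?_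
    rw [sum_mul]
    exact sum_congr rfl fun v _ ↦ by rw [adjInd_comm]
  have h1 : ∑ u, ∑ v, G.adjInd u v * x u ^ 2 = ∑ u, (∑ v, G.adjInd u v) * x u ^ 2 :=
    sum_congr rfl fun u _ ↦ by rw [sum_mul]
  calc G.qForm x ≤ ∑ u, ∑ v, (2 * (G.adjInd u v * x u ^ 2) + 2 * (G.adjInd u v * x v ^ 2)) := by
        -- This is `(a + b)² ≤ 2a² + 2b²`; the slack is `(x u - x v)²`.
        refine sum_le_sum fun u _ ↦ sum_le_sum fun v _ ↦ ?_
        have := mul_nonneg (G.adjInd_nonneg u v) (sq_nonneg (x u - x v))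
        nlinarith
    _ = 4 * ∑ u, (∑ v, G.adjInd u v) * x u ^ 2 := by
        simp only [sum_add_distrib, ← mul_sum, h1, h2]; ring

theorem qForm_le (x : V → ℝ) : G.qForm x ≤ 4 * Fintype.card V * ∑ u, x u ^ 2 := by
  refine (G.qForm_le_four_mul_sum x).trans ?_
  rw [mul_assoc, mul_sum univ _ (Fintype.card V : ℝ)]
  gcongr with u
  exact G.sum_adjInd_le_card u

/-- A nonnegative unit vector maximizing the signless Laplacian form satisfies the eigenvector
equation. -/
theorem exists_isMax_qForm [Nonempty V] :
    ∃ (x : V → ℝ) (μ : ℝ), (∀ v, 0 ≤ x v) ∧ ∑ v, x v ^ 2 = 1 ∧ G.qForm x = 2 * μ ∧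
      (∀ y : V → ℝ, G.qForm y ≤ 2 * μ * ∑ v, y v ^ 2) ∧
      ∀ u, ∑ v, G.adjInd u v * (x u + x v) = μ * x u := by
  classical
  have hcont : Continuous fun x : V → ℝ ↦ ∑ v, x v ^ 2 := by fun_prop
  have hcomp : IsCompact {x : V → ℝ | ∑ v, x v ^ 2 = 1} := by
    refine Metric.isCompact_of_isClosed_isBounded (isClosed_eq hcont continuous_const) ?_
    refine (Metric.isBounded_closedBall (x := (0 : V → ℝ)) (r := 1)).subset fun x hx ↦ ?_
    rw [mem_closedBall_zero_iff, pi_norm_le_iff_of_nonneg zero_le_one]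
    intro v
    have h1 : x v ^ 2 ≤ 1 := by
      rw [← show ∑ v, x v ^ 2 = 1 from hx]
      exact single_le_sum (f := fun v ↦ x v ^ 2) (fun i _ ↦ sq_nonneg _) (mem_univ v)
    rw [Real.norm_eq_abs]
    exact (sq_le_one_iff_abs_le_one _).mp h1
  have hne : {x : V → ℝ | ∑ v, x v ^ 2 = 1}.Nonempty := by
    obtain ⟨v⟩ := ‹Nonempty V›
    refine ⟨Pi.single v 1, ?_⟩
    simp [Pi.single_apply, ite_pow]
  have hq : Continuous G.qForm := by unfold qForm; fun_prop
  obtain ⟨x₀, hx₀, hmax₀⟩ := hcomp.exists_isMaxOn hne hq.continuousOn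
  set x : V → ℝ := fun v ↦ |x₀ v|
  have hx : ∑ v, x v ^ 2 = 1 := by simpa [x] using hx₀
  have hge : G.qForm x₀ ≤ G.qForm x := by
    refine sum_le_sum fun u _ ↦ sum_le_sum fun v _ ↦ ?_
    refine mul_le_mul_of_nonneg_left ?_ (G.adjInd_nonneg u v)
    rw [← sq_abs (x₀ u + x₀ v)]
    gcongr
    exact abs_add_le _ _
  have hmax (y : V → ℝ) : G.qForm y ≤ G.qForm x * ∑ v, y v ^ 2 := by
    rcases (sum_nonneg fun v _ ↦ sq_nonneg (y v) : 0 ≤ ∑ v, y v ^ 2).eq_or_lt with h0 | hpos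
    · have := G.qForm_le y
      rw [← h0] at this ⊢
      linarith
    · set S := ∑ v, y v ^ 2
      have hs : (√S)⁻¹ ^ 2 = S⁻¹ := by rw [inv_pow, Real.sq_sqrt hpos.le]
      have h1 : ∑ v, ((√S)⁻¹ * y v) ^ 2 = 1 := by
        simp only [mul_pow, ← mul_sum, hs]
        exact inv_mul_cancel₀ hpos.ne'
      have h2 := (hmax₀ h1 : G.qForm (fun v ↦ (√S)⁻¹ * y v) ≤ G.qForm x₀).trans hge
      rw [qForm_smul, hs, inv_mul_le_iff₀ hpos] at h2
      linarith
  refine ⟨x, G.qForm x / 2, fun v ↦ abs_nonneg _, hx, by ring, fun y ↦ ?_, fun u ↦ ?_⟩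
  · have := hmax y; linarith
  -- First-order optimality: perturb the maximizer in the single coordinate `u` and expand to second
  -- order in `t`.
  · have hexp (t : ℝ) : G.qForm (fun v ↦ x v + t * (if v = u then (1 : ℝ) else 0))
        = G.qForm x + 4 * t * (∑ v, G.adjInd u v * (x u + x v))
          + t ^ 2 * G.qForm (fun v ↦ if v = u then 1 else 0) := by
      have h1 : ∑ a, ∑ v, G.adjInd a v * ((x a + x v) *
          ((if a = u then (1 : ℝ) else 0) + (if v = u then (1 : ℝ) else 0)))
          = 2 * ∑ v, G.adjInd u v * (x u + x v) := by
        have hl : ∑ a, ∑ v, G.adjInd a v * (x a + x v) * (if a = u then (1 : ℝ) else 0)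
            = ∑ v, G.adjInd u v * (x u + x v) := by
          rw [sum_comm]
          exact sum_congr rfl fun v _ ↦ by simp
        have hr : ∑ a, ∑ v, G.adjInd a v * (x a + x v) * (if v = u then (1 : ℝ) else 0)
            = ∑ v, G.adjInd u v * (x u + x v) := by
          refine sum_congr rfl fun v _ ↦ ?_
          simp only [mul_ite, mul_one, mul_zero, sum_ite_eq', mem_univ, if_true]
          rw [G.adjInd_comm v u, add_comm]
        simp only [← mul_assoc, mul_add (_ * _) (ite _ _ _), sum_add_distrib, hl, hr]
        ring
      have h2 : 4 * t * (∑ v, G.adjInd u v * (x u + x v)) = 2 * t * (∑ a, ∑ v, G.adjInd a v *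
          ((x a + x v) * ((if a = u then (1 : ℝ) else 0) + (if v = u then (1 : ℝ) else 0)))) := by
        rw [h1]; ring
      rw [h2]
      simp only [qForm, mul_sum, ← sum_add_distrib]
      exact sum_congr rfl fun a _ ↦ sum_congr rfl fun v _ ↦ by ring
    have hsq (t : ℝ) : ∑ v, (x v + t * (if v = u then (1 : ℝ) else 0)) ^ 2
        = 1 + 2 * t * x u + t ^ 2 := by
      have : ∀ v, (x v + t * (if v = u then (1 : ℝ) else 0)) ^ 2
          = x v ^ 2 + (if v = u then 2 * t * x v + t ^ 2 else 0) := by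
        intro v; split_ifs <;> ring
      simp only [this, sum_add_distrib, hx, sum_ite_eq', mem_univ, if_true]; ring
    set B := ∑ v, G.adjInd u v * (x u + x v)
    set E := G.qForm (fun v ↦ if v = u then (1 : ℝ) else 0)
    set M := G.qForm x
    have hineq (t : ℝ) : 0 ≤ t * (2 * M * x u - 4 * B) + t ^ 2 * (M - E) := by
      have := hmax (fun v ↦ x v + t * (if v = u then (1 : ℝ) else 0))
      rw [hexp, hsq] at this
      nlinarith
    set b := 2 * M * x u - 4 * B
    have hb : b = 0 := by
      by_contra hb
      -- With `t` a small multiple of `-b`, the linear term dominates the quadratic one and the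
      -- expression is negative unless `b = 0`.
      have h1 := hineq (-b / (2 * (|M - E| + 1)))
      have hp : 0 < |M - E| + 1 := by positivity
      have h2 : (-b / (2 * (|M - E| + 1))) * b + (-b / (2 * (|M - E| + 1))) ^ 2 * (M - E)
          = b ^ 2 / (4 * (|M - E| + 1) ^ 2) * ((M - E) - 2 * (|M - E| + 1)) := by
        field_simp; ring
      rw [h2] at h1
      have h3 : (M - E) - 2 * (|M - E| + 1) < 0 := by
        have := le_abs_self (M - E); linarith [abs_nonneg (M - E)]
      have h4 : 0 < b ^ 2 / (4 * (|M - E| + 1) ^ 2) := by positivity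
      nlinarith
    simp only [b] at hb
    linarith

end Spectral

/-! ### Deleting vertices with small eigenvector entry. -/

section Deletion

variable {V : Type*} [Fintype V] (G : SimpleGraph V)

theorem IsQLower.mono {G : SimpleGraph V} {q q' : ℝ} (h : G.IsQLower q) (hq : q' ≤ q) :
    G.IsQLower q' :=
  let ⟨x, hx, hx'⟩ := h
  ⟨x, hx, by linarith⟩

theorem isQLower_of_mul_sum_le {x : V → ℝ} {q : ℝ} (hpos : 0 < ∑ v, x v ^ 2)
    (h : 2 * q * ∑ v, x v ^ 2 ≤ G.qForm x) : G.IsQLower q := by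
  set S := ∑ v, x v ^ 2
  have hs : (√S)⁻¹ ^ 2 = S⁻¹ := by rw [inv_pow, Real.sq_sqrt hpos.le]
  refine ⟨fun v ↦ (√S)⁻¹ * x v, ?_, ?_⟩
  · simp only [mul_pow, ← mul_sum, hs]
    exact inv_mul_cancel₀ hpos.ne'
  · rw [qForm_smul, hs, le_inv_mul_iff₀ hpos]
    linarith

theorem IsQLower.le_two_mul_card {G : SimpleGraph V} {q : ℝ} (h : G.IsQLower q) :
    q ≤ 2 * Fintype.card V := by
  obtain ⟨x, hx, hx'⟩ := h
  have := G.qForm_le x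
  rw [hx] at this
  linarith

/-- Deleting a vertex whose entry in the principal eigenvector is smallest. -/
theorem isQLower_comap_of_isMin [DecidableEq V] {x : V → ℝ} {μ : ℝ} (hx : ∑ v, x v ^ 2 = 1)
    (hμ : G.qForm x = 2 * μ) (heig : ∀ u, ∑ v, G.adjInd u v * (x u + x v) = μ * x u)
    {v : V} (hv : ∀ u, x v ^ 2 ≤ x u ^ 2) (hv1 : x v ^ 2 < 1) :
    (G.comap (Subtype.val : {u // u ≠ v} → V)).IsQLower
      ((μ - 1 - (2 * μ - Fintype.card V) * x v ^ 2) / (1 - x v ^ 2)) := by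
  have hsum : ∑ u : {u // u ≠ v}, x u ^ 2 = 1 - x v ^ 2 := by
    rw [← hx, Fintype.sum_eq_add_sum_subtype_ne _ v]; ring
  have hform : G.qForm x = 2 * ∑ w, G.adjInd v w * (x v + x w) ^ 2
      + (G.comap (Subtype.val : {u // u ≠ v} → V)).qForm (fun u ↦ x u) :=
    sum_sum_eq_add_sum_sum_subtype_ne v (fun u w ↦ G.adjInd u w * (x u + x w) ^ 2)
      (fun u w ↦ by rw [G.adjInd_comm]; ring) (by simp)
  have hrow : ∑ w, G.adjInd v w * (x v + x w) ^ 2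
      ≤ 1 + (2 * μ - Fintype.card V) * x v ^ 2 := by
    -- For neighbours this is the identity `(a + b)² = 2a(a + b) + (b² - a²)`; for non-neighbours
    -- the right side is nonnegative because the entry at `v` is smallest. Extending the sum to all
    -- `w` lets the eigenvector equation and the normalization evaluate it.
    have h1 : ∀ w, G.adjInd v w * (x v + x w) ^ 2
        ≤ 2 * x v * (G.adjInd v w * (x v + x w)) + (x w ^ 2 - x v ^ 2) := by
      intro w
      have h2 := mul_nonneg (sub_nonneg.mpr (G.adjInd_le_one v w)) (sub_nonneg.mpr (hv w))
      nlinarith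
    calc _ ≤ ∑ w, (2 * x v * (G.adjInd v w * (x v + x w)) + (x w ^ 2 - x v ^ 2)) :=
          sum_le_sum fun w _ ↦ h1 w
      _ = _ := by
          rw [sum_add_distrib, ← mul_sum, heig, sum_sub_distrib, hx]
          simp; ring
  have hpos : 0 < 1 - x v ^ 2 := by linarith
  refine isQLower_of_mul_sum_le (x := fun u : {u // u ≠ v} ↦ x u) _ (by rw [hsum]; exact hpos) ?_
  rw [hsum, mul_assoc, div_mul_cancel₀ _ hpos.ne']
  linarith

/-- If the principal eigenvector has no small entry, the `Q`-index is controlled by the number of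
edges. -/
theorem le_pairCount_of_le_sq [Nonempty V] {x : V → ℝ} {μ β η : ℝ} (hη : 0 ≤ η)
    (hx : ∑ v, x v ^ 2 = 1)
    (hμ : G.qForm x = 2 * μ) (hβ : β * Fintype.card V ≤ μ)
    (hmin : ∀ u, (1 - η) / Fintype.card V ≤ x u ^ 2) :
    (β / 2 - η) * (Fintype.card V : ℝ) ^ 2 ≤ G.pairCount := by
  set n : ℝ := (Fintype.card V : ℝ)
  have hn : 0 < n := by simp only [n]; exact_mod_cast Fintype.card_pos
  have h1 := G.qForm_le_four_mul_sum x
  -- Split each squared entry into the floor `(1 - η) / n` and an excess. The excesses total `η`,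
  -- and each is weighted by a degree of at most `n`.
  have h2 : ∑ u, (∑ v, G.adjInd u v) * x u ^ 2
      ≤ ∑ u, ((∑ v, G.adjInd u v) * ((1 - η) / n) + n * (x u ^ 2 - (1 - η) / n)) := by
    refine sum_le_sum fun u _ ↦ ?_
    have h3 := mul_nonneg (sub_nonneg.mpr (G.sum_adjInd_le_card u)) (sub_nonneg.mpr (hmin u))
    simp only [n] at h3 ⊢
    linarith
  have h4 : ∑ u, ((∑ v, G.adjInd u v) * ((1 - η) / n) + n * (x u ^ 2 - (1 - η) / n))
      = G.pairCount * ((1 - η) / n) + n * η := by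
    have hnn : n * ((1 - η) / n) = 1 - η := by field_simp
    rw [sum_add_distrib, ← sum_mul, ← mul_sum, sum_sub_distrib, hx, sum_const, card_univ,
      nsmul_eq_mul, show ((Fintype.card V : ℕ) : ℝ) = n from rfl, hnn, pairCount]
    ring
  have hD : 0 ≤ G.pairCount := sum_nonneg fun u _ ↦ G.sum_adjInd_nonneg u
  have h5 : G.pairCount * ((1 - η) / n) ≤ G.pairCount / n := by
    rw [mul_div_assoc']
    gcongr
    nlinarith
  have h6 : (β / 2 - η) * n ≤ G.pairCount / n := by linarith
  rw [le_div_iff₀ hn] at h6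
  linarith

end Deletion

/-- With `μ = b n` and `z = w / n`, clearing denominators leaves a main gain of `(b - 1)(1 - w) ≥
η(β₀ - 1)`. Half of it is the claimed increment `θ`; the other half absorbs the error `b w / n`,
since `n` is large. The gain is positive only because `q/n` exceeds 1, whence the later condition `1
/ 2 < c`. -/
theorem increment_le {n μ z β β₀ η : ℝ} (hη : 0 < η) (hβ₀ : 1 < β₀) (hβ : β₀ ≤ β)
    (hn : 4 ≤ η * (β₀ - 1) * n) (hn1 : 1 ≤ n) (hμ : β * n ≤ μ) (hμ2 : μ ≤ 2 * n)
    (hz : 0 ≤ z) (hz' : z < (1 - η) / n) (hz1 : z < 1) :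
    (β + η * (β₀ - 1) / 2 / n) * (n - 1) ≤ (μ - 1 - (2 * μ - n) * z) / (1 - z) := by
  have hn0 : 0 < n := by linarith
  rw [le_div_iff₀ (by linarith)]
  obtain ⟨b, rfl⟩ : ∃ b, μ = b * n := ⟨μ / n, by field_simp⟩
  have hb : β ≤ b := le_of_mul_le_mul_right hμ hn0
  have hb2 : b ≤ 2 := le_of_mul_le_mul_right hμ2 hn0
  obtain ⟨w, rfl⟩ : ∃ w, z = w / n := ⟨z * n, by field_simp⟩
  have hw : w < 1 - η := by rwa [div_lt_div_iff_of_pos_right hn0] at hz'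
  have hw0 : 0 ≤ w := by
    have := mul_nonneg hz hn0.le
    rwa [div_mul_cancel₀ _ hn0.ne'] at this
  set θ := η * (β₀ - 1) / 2
  have hθ : 0 < θ := by simp only [θ]; apply div_pos (mul_pos hη (by linarith)) two_pos
  have h2n : 2 / n ≤ θ := by
    rw [div_le_iff₀ hn0]; simp only [θ]; linarith
  have hle : (β + θ / n) * (n - 1) ≤ b * n - b + θ := by
    have h1 : (β + θ / n) * (n - 1) ≤ (b + θ / n) * (n - 1) := by
      apply mul_le_mul_of_nonneg_right _ (by linarith); linarith
    have h2 : (b + θ / n) * (n - 1) = b * n - b + θ - θ / n := by field_simp; ring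
    have h3 : 0 < θ / n := by positivity
    linarith
  have h1z : 0 ≤ 1 - w / n := by linarith
  refine (mul_le_mul_of_nonneg_right hle h1z).trans ?_
  have e1 : n * (w / n) = w := by field_simp
  have hwn : w / n ≤ 1 / n := by gcongr; linarith
  have h2n' : 2 * (1 / n) ≤ θ := by rw [mul_one_div]; exact h2n
  have hA : b * (w / n) ≤ θ := by
    have : b * (w / n) ≤ 2 * (w / n) := by gcongr
    linarith
  have hB : (b - 1) * w ≤ (b - 1) * (1 - η) :=
    mul_le_mul_of_nonneg_left hw.le (by linarith)
  have hC : η * (β₀ - 1) ≤ η * (b - 1) := by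
    apply mul_le_mul_of_nonneg_left _ hη.le; linarith
  have hθ2 : 2 * θ = η * (β₀ - 1) := by simp only [θ]; ring
  have hD : 0 ≤ θ * (w / n) := mul_nonneg hθ.le hz
  have e2 : (b * n - 1 - (2 * (b * n) - n) * (w / n)) = b * n - 1 - (2 * b - 1) * w := by
    field_simp
  rw [e2]
  have e3 : (b * n - b + θ) * (1 - w / n)
      = b * n - b + θ - b * w + b * (w / n) - θ * (w / n) := by
    field_simp; ring
  rw [e3]
  linarith

/-- Repeatedly deleting vertices with a small entry in the principal eigenvector either reaches a
subgraph whose number of edges is as large as the `Q`-index suggests, or increases the `Q`-index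
density. -/
theorem exists_isContained_dense_or_increment {β₀ η : ℝ} (hη : 0 < η) (hβ₀ : 1 < β₀) (m : ℕ)
    (hm1 : 1 ≤ m) (hm : 4 ≤ η * (β₀ - 1) * m) (n : ℕ) (hmn : m ≤ n) :
    ∀ (V : Type u) [Fintype V] (G : SimpleGraph V) (β : ℝ), Fintype.card V = n → β₀ ≤ β →
      G.IsQLower (β * n) →
      ∃ (V' : Type u) (_ : Fintype V') (G' : SimpleGraph V'), G' ⊑ G ∧ m ≤ Fintype.card V' ∧
        ((β / 2 - η) * (Fintype.card V' : ℝ) ^ 2 ≤ G'.pairCount ∨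
          Fintype.card V' = m ∧ G'.IsQLower ((β + η * (β₀ - 1) / 2 * ((n - m) / n)) * m)) := by
  classical
  induction n, hmn using Nat.le_induction with
  | base =>
    intro V _ G β hV _ hq
    refine ⟨V, inferInstance, G, IsContained.rfl, hV.ge, .inr ⟨hV, ?_⟩⟩
    simpa using hq
  | succ n hmn ih =>
    intro V _ G β hV hβ hq
    have : Nonempty V := Fintype.card_pos_iff.mp (by omega)
    obtain ⟨x, μ, hx0, hx, hμ, hmax, heig⟩ := G.exists_isMax_qForm
    obtain ⟨y, hy, hy'⟩ := hq
    have hβμ : β * (n + 1 : ℕ) ≤ μ := by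
      have := hmax y; rw [hy] at this; linarith
    obtain ⟨v, -, hv⟩ := exists_min_image univ (fun v ↦ x v ^ 2) univ_nonempty
    by_cases hsmall : (1 - η) / (n + 1 : ℕ) ≤ x v ^ 2
    · refine ⟨V, inferInstance, G, IsContained.rfl, by omega, .inl ?_⟩
      refine G.le_pairCount_of_le_sq hη.le hx hμ (by rwa [hV]) fun u ↦ ?_
      rw [hV]
      exact hsmall.trans (hv u (mem_univ u))
    · rw [not_le] at hsmall
      have hmR : (m : ℝ) ≤ n := by exact_mod_cast hmn
      have hn0 : (1 : ℝ) ≤ m := by exact_mod_cast hm1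
      have hnpos : (0 : ℝ) < n := by linarith
      have hηβ : 0 < η * (β₀ - 1) := mul_pos hη (by linarith)
      have hv1 : x v ^ 2 < 1 := by
        refine hsmall.trans_le ?_
        rw [div_le_one (by positivity)]
        push_cast; linarith
      have hdel := G.isQLower_comap_of_isMin hx hμ heig (fun u ↦ hv u (mem_univ u)) hv1
      have hμ2 : μ ≤ 2 * (n + 1 : ℕ) := by
        have := G.qForm_le x
        rw [hx, hμ, hV] at this; linarith
      have hinc := increment_le (n := (n + 1 : ℕ)) hη hβ₀ hβ
        (hm.trans (by push_cast; gcongr; linarith)) (by push_cast; linarith) hβμ hμ2 (sq_nonneg _)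
        hsmall hv1
      rw [hV] at hdel
      have hdel2 := hdel.mono hinc
      rw [show ((n + 1 : ℕ) : ℝ) - 1 = n by push_cast; ring] at hdel2
      have hθpos : 0 < η * (β₀ - 1) / 2 / ((n + 1 : ℕ) : ℝ) := by positivity
      obtain ⟨V', _, G', hG', hcard, hor⟩ := ih {u // u ≠ v} (G.comap Subtype.val) _
        (by rw [card_subtype_ne, hV]; rfl) (by linarith) hdel2
      refine ⟨V', inferInstance, G', hG'.trans (G.comap_val_isContained _), hcard, ?_⟩
      rcases hor with h | ⟨h1, h2⟩
      · refine .inl (le_trans ?_ h)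
        gcongr
        linarith
      · refine .inr ⟨h1, h2.mono ?_⟩
        -- The successive gains are proportional to `1 / j` for `m < j ≤ n`, and each is at least `1
        -- / n`; this is the inductive form of that bound on their sum.
        have hstep : (((n + 1 : ℕ) : ℝ) - m) / (n + 1 : ℕ) ≤ 1 / (n + 1 : ℕ) + (n - m) / n := by
          have : (n - m : ℝ) / (n + 1 : ℕ) ≤ (n - m) / n := by
            apply div_le_div_of_nonneg_left (by linarith) hnpos
            push_cast; linarith
          calc _ = 1 / ((n + 1 : ℕ) : ℝ) + (n - m) / (n + 1 : ℕ) := by push_cast; field_simp; ring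
            _ ≤ _ := by linarith
        have h3 : η * (β₀ - 1) / 2 * ((((n + 1 : ℕ) : ℝ) - m) / (n + 1 : ℕ))
            ≤ η * (β₀ - 1) / 2 * (1 / (n + 1 : ℕ) + (n - m) / n) := by gcongr
        have h4 : η * (β₀ - 1) / 2 / ((n + 1 : ℕ) : ℝ) = η * (β₀ - 1) / 2 * (1 / (n + 1 : ℕ)) := by
          ring
        apply mul_le_mul_of_nonneg_right _ (by linarith)
        rw [h4]; linarith

/-! ### From edge density bounds to `Q`-index bounds and back. -/

section Transfer

variable {W : Type*} (H : SimpleGraph W) (c : ℝ)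

/-- Asymptotic upper bound for the edge density of `H`-free graphs. -/
def HasDensityBound : Prop :=
  ∀ ε : ℝ, 0 < ε → ∃ N : ℕ, ∀ (V : Type u) [Fintype V] (G : SimpleGraph V), N ≤ Fintype.card V →
    H.Free G → G.pairCount ≤ (c + ε) * (Fintype.card V : ℝ) ^ 2

/-- Eventual upper bound for the `Q`-index of `H`-free graphs. -/
def HasQBound : Prop :=
  ∃ N : ℕ, ∀ (V : Type u) [Fintype V] (G : SimpleGraph V), N ≤ Fintype.card V →
    H.Free G → ∀ q, G.IsQLower q → q ≤ c * Fintype.card V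

variable {H c}

theorem HasQBound.mono {c' : ℝ} (h : HasQBound.{u} H c) (hc : c ≤ c') : HasQBound.{u} H c' :=
  let ⟨N, hN⟩ := h
  ⟨N, fun V _ G hV hG q hq ↦ (hN V G hV hG q hq).trans (by gcongr)⟩

/-- If the claim failed, all valid eventual bounds would be at least `2c + τ`. Take one, `β`, within
`γ` of their infimum. A graph violating `β - γ` would, after deleting down to half its order, yield
either a subgraph denser than `c` allows or one violating `β`. So `β - γ` is also valid, below the
infimum. -/
theorem HasDensityBound.hasQBound (h : HasDensityBound.{u} H c) (hc : 1 / 2 < c) {τ : ℝ}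
    (hτ : 0 < τ) : HasQBound.{u} H (2 * c + τ) := by
  by_contra hnot
  have hlb : 2 * c + τ ∈ lowerBounds {β | HasQBound.{u} H β} := fun β hβ ↦ by
    by_contra hlt
    exact hnot (hβ.mono (not_le.mp hlt).le)
  have hne : {β | HasQBound.{u} H β}.Nonempty := ⟨2, 0, fun V _ G _ _ q hq ↦ hq.le_two_mul_card⟩
  set η := τ / 4
  have hη : 0 < η := by positivity
  set θ := η * (2 * c - 1) / 2
  have hθ : 0 < θ := by
    simp only [θ]; apply div_pos (mul_pos hη (by linarith)) two_pos
  -- The gain from halving the order is at least `θ / 2`, which must exceed `γ`; the bound `τ / 4`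
  -- keeps `(β - γ) / 2 - η` above `c + τ / 16`.
  set γ := min (θ / 8) (τ / 4)
  have hγ : 0 < γ := by positivity
  have hγ1 : γ ≤ θ / 8 := min_le_left _ _
  have hγ2 : γ ≤ τ / 4 := min_le_right _ _
  obtain ⟨β, hβ, hβlt⟩ := exists_lt_of_csInf_lt hne (lt_add_of_pos_right _ hγ)
  have hβ2 : 2 * c + τ ≤ β := hlb hβ
  suffices HasQBound.{u} H (β - γ) by
    have := csInf_le ⟨_, hlb⟩ this
    linarith
  obtain ⟨N₁, hN₁⟩ := hβ
  obtain ⟨N₂, hN₂⟩ := h (τ / 16) (by positivity)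
  obtain ⟨N₃, hN₃⟩ := exists_nat_ge (4 / (η * (2 * c - 1)))
  have hηc : 0 < η * (2 * c - 1) := mul_pos hη (by linarith)
  rw [div_le_iff₀ hηc] at hN₃
  refine ⟨2 * (N₁ + N₂ + N₃ + 1), fun V _ G hV hG q hq ↦ ?_⟩
  by_contra! hlt
  set n := Fintype.card V
  have hm : N₁ + N₂ + N₃ + 1 ≤ n / 2 := by omega
  have hmpos : (0 : ℝ) < (n / 2 : ℕ) := by exact_mod_cast (by omega : 0 < n / 2)
  obtain ⟨V', _, G', hG', hcard, hor⟩ := exists_isContained_dense_or_increment hη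
    (by linarith : 1 < 2 * c) (n / 2) (by omega)
    (by
      have : (N₃ : ℝ) ≤ (n / 2 : ℕ) := by exact_mod_cast (by omega : N₃ ≤ n / 2)
      have : (N₃ : ℝ) * (η * (2 * c - 1)) ≤ (n / 2 : ℕ) * (η * (2 * c - 1)) := by gcongr
      linarith) n (by omega) V G (β - γ) rfl (by linarith)
    (hq.mono hlt.le)
  have hfree : H.Free G' := fun h ↦ hG (h.trans hG')
  rcases hor with h1 | ⟨h1, h2⟩
  · have h3 := h1.trans (hN₂ V' G' (by omega) hfree)
    have h4 : (0 : ℝ) < (Fintype.card V' : ℝ) ^ 2 := by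
      have : 0 < Fintype.card V' := by omega
      positivity
    have h5 := le_of_mul_le_mul_right h3 h4
    simp only [η] at h5
    linarith
  · have h3 := hN₁ V' G' (by omega) hfree _ h2
    rw [h1] at h3
    have h4 := le_of_mul_le_mul_right h3 hmpos
    have hhalf : (1 / 2 : ℝ) ≤ ((n : ℝ) - (n / 2 : ℕ)) / n := by
      have : (0 : ℝ) < n := by exact_mod_cast (by omega : 0 < n)
      rw [le_div_iff₀ this]
      have : ((n / 2 : ℕ) : ℝ) ≤ n / 2 := Nat.cast_div_le
      linarith
    rw [show η * (2 * c - 1) / 2 = θ from rfl] at h4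
    have h5 : θ * (1 / 2) ≤ θ * (((n : ℝ) - (n / 2 : ℕ)) / n) := by gcongr
    linarith

/-- Graphs without `H` whose `Q`-index is asymptotically maximal have asymptotically maximal edge
density. -/
theorem HasDensityBound.exists_le_pairCount (h : HasDensityBound.{u} H c) (hc : 1 / 2 < c)
    (hc1 : c ≤ 1) {δ : ℝ} (hδ : 0 < δ) :
    ∃ σ : ℝ, 0 < σ ∧ ∃ N : ℕ, ∀ (V : Type u) [Fintype V] (G : SimpleGraph V),
      N ≤ Fintype.card V → H.Free G → G.IsQLower ((2 * c - σ) * Fintype.card V) →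
      (c - δ) * (Fintype.card V : ℝ) ^ 2 ≤ G.pairCount := by
  set δ₁ := min (δ / 8) (1 / 2)
  have hδ₁ : 0 < δ₁ := by positivity
  have hδ₁1 : δ₁ ≤ δ / 8 := min_le_left _ _
  have hδ₁2 : δ₁ ≤ 1 / 2 := min_le_right _ _
  set η := min (δ / 4) (1 / 8)
  have hη : 0 < η := by positivity
  have hη1 : η ≤ δ / 4 := min_le_left _ _
  have hη2 : η ≤ 1 / 8 := min_le_right _ _
  set β₀ := c + 1 / 2
  have hβ₀ : 1 < β₀ := by simp only [β₀]; linarith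
  have hηβ : 0 < η * (β₀ - 1) := mul_pos hη (by linarith)
  set θ := η * (β₀ - 1) / 2
  have hθ : 0 < θ := by positivity
  -- The last term makes the gain `θ * δ₁ / 2` from deleting nearly a fraction `δ₁` of the vertices
  -- exceed `2σ`, the gap between the hypothesis `2c - σ` and the eventual bound `2c + σ`. The term
  -- `c - 1 / 2` keeps `2c - σ` above `β₀`.
  set σ := min (min (δ / 2) (1 / 8)) (min (c - 1 / 2) (θ * δ₁ / 8))
  have hσ1 : σ ≤ δ / 2 := (min_le_left _ _).trans (min_le_left _ _)
  have hσ2 : σ ≤ 1 / 8 := (min_le_left _ _).trans (min_le_right _ _)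
  have hσ3 : σ ≤ c - 1 / 2 := (min_le_right _ _).trans (min_le_left _ _)
  have hσ4 : σ ≤ θ * δ₁ / 8 := (min_le_right _ _).trans (min_le_right _ _)
  have hσ : 0 < σ := by
    refine lt_min (by positivity) (lt_min (by linarith) (by positivity))
  obtain ⟨N₁, hN₁⟩ := h.hasQBound hc hσ
  obtain ⟨N₃, hN₃⟩ := exists_nat_ge (4 / (η * (β₀ - 1)))
  rw [div_le_iff₀ hηβ] at hN₃
  obtain ⟨N₂, hN₂⟩ := exists_nat_ge (2 / δ₁)
  rw [div_le_iff₀ hδ₁] at hN₂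
  refine ⟨σ, hσ, 2 * (N₁ + N₂ + N₃ + 1), fun V _ G hV hG hq ↦ ?_⟩
  set n := Fintype.card V
  have hnR : (2 : ℝ) * (N₁ + N₂ + N₃ + 1) ≤ n := by exact_mod_cast hV
  have hn0 : (0 : ℝ) < n := by
    have : (0 : ℝ) ≤ N₁ + N₂ + N₃ := by positivity
    linarith
  set m := ⌈(1 - δ₁) * n⌉₊
  have hm1 : (1 - δ₁) * n ≤ m := Nat.le_ceil _
  have hm2 : (m : ℝ) < (1 - δ₁) * n + 1 := Nat.ceil_lt_add_one (by
    apply mul_nonneg (by linarith) hn0.le)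
  have hδn : δ₁ * n ≤ 1 / 2 * n := by gcongr
  have hδn0 : 0 < δ₁ * n := by positivity
  have hmhalf : (n : ℝ) / 2 ≤ m := by linarith
  have hmN : N₁ + N₂ + N₃ + 1 ≤ m := by
    have : ((N₁ + N₂ + N₃ + 1 : ℕ) : ℝ) ≤ m := by push_cast; linarith
    exact_mod_cast this
  have hmn : m ≤ n := Nat.ceil_le.mpr (by linarith)
  have hmpos : (0 : ℝ) < m := by linarith
  obtain ⟨V', _, G', hG', hcard, hor⟩ := exists_isContained_dense_or_increment hη hβ₀ m (by omega)
    (by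
      have : (N₃ : ℝ) ≤ m := by exact_mod_cast (by omega : N₃ ≤ m)
      have : (N₃ : ℝ) * (η * (β₀ - 1)) ≤ m * (η * (β₀ - 1)) := by gcongr
      linarith) n hmn V G (2 * c - σ) rfl (by simp only [β₀]; linarith) hq
  have hfree : H.Free G' := fun h ↦ hG (h.trans hG')
  rcases hor with h1 | ⟨h1, h2⟩
  · refine le_trans ?_ (pairCount_mono hG')
    refine le_trans ?_ h1
    have hcm : (m : ℝ) ≤ Fintype.card V' := by exact_mod_cast hcard
    have h3 : ((1 - δ₁) * n) ^ 2 ≤ (Fintype.card V' : ℝ) ^ 2 := by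
      have : 0 ≤ (1 - δ₁) * n := mul_nonneg (by linarith) hn0.le
      gcongr
      linarith
    have h4 : 0 ≤ (2 * c - σ) / 2 - η := by linarith
    refine le_trans ?_ (mul_le_mul_of_nonneg_left h3 h4)
    rw [mul_pow, ← mul_assoc]
    gcongr
    have h5 : ((2 * c - σ) / 2 - η) * (1 - 2 * δ₁) ≤ ((2 * c - σ) / 2 - η) * (1 - δ₁) ^ 2 := by
      gcongr
      linarith [sq_nonneg δ₁]
    have h6 : ((2 * c - σ) / 2 - η) * δ₁ ≤ 1 * δ₁ := by
      gcongr
      linarith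
    linarith
  · exfalso
    have h3 := hN₁ V' G' (by omega) hfree _ h2
    rw [h1] at h3
    have h4 := le_of_mul_le_mul_right h3 hmpos
    have hge : δ₁ / 2 ≤ ((n : ℝ) - m) / n := by
      rw [le_div_iff₀ hn0]
      have hN₂n : (N₂ : ℝ) ≤ n := by
        have : (0 : ℝ) ≤ N₁ + N₂ + N₃ := by positivity
        have : (0 : ℝ) ≤ N₁ + N₃ := by positivity
        linarith
      have : (N₂ : ℝ) * δ₁ ≤ n * δ₁ := by gcongr
      linarith
    rw [show η * (β₀ - 1) / 2 = θ from rfl] at h4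
    have h5 : θ * (δ₁ / 2) ≤ θ * (((n : ℝ) - m) / n) := by gcongr
    have h6 : 0 < θ * δ₁ := by positivity
    linarith

end Transfer

/-! ### Assembling equipartite graphs; removing low-degree vertices. -/

section Build

variable {V : Type*} {G : SimpleGraph V}

/-- A family of large, pairwise completely joined vertex sets contains a complete equipartite
graph. -/
theorem completeEquipartiteGraph_isContained_of_family {ι : Type*} [Fintype ι] {r s : ℕ}
    (hι : Fintype.card ι = r) (P : ι → Finset V) (hcard : ∀ a, s ≤ #(P a))
    (hadj : ∀ a b, a ≠ b → ∀ u ∈ P a, ∀ v ∈ P b, G.Adj u v) :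
    completeEquipartiteGraph r s ⊑ G := by
  have e : Fin r ≃ ι := (Fintype.equivFinOfCardEq hι).symm
  have hemb (a : ι) : Nonempty (Fin s ↪ P a) := by
    rw [Function.Embedding.nonempty_iff_card_le]
    simpa using hcard a
  have g (a : ι) : Fin s ↪ P a := (hemb a).some
  refine ⟨⟨⟨fun x ↦ (g (e x.1) x.2 : V), fun {x y} hxy ↦ ?_⟩, fun x y hxy ↦ ?_⟩⟩
  · exact hadj _ _ (e.injective.ne hxy) _ (g _ _).2 _ (g _ _).2
  · obtain ⟨x1, x2⟩ := x
    obtain ⟨y1, y2⟩ := y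
    have hxy' : (g (e x1) x2 : V) = g (e y1) y2 := hxy
    by_cases h : x1 = y1
    · subst h
      rw [(g (e x1)).injective (Subtype.ext hxy')]
    · have := hadj _ _ (e.injective.ne h) _ (g (e x1) x2).2 _ (g (e y1) y2).2
      rw [hxy'] at this
      exact absurd this G.irrefl

end Build

section Induced

variable {V : Type*} [Fintype V] [DecidableEq V] (G : SimpleGraph V)

theorem pairCount_le_pairCount_comap_add (S : Finset V) :
    G.pairCount ≤ (G.comap (Subtype.val : S → V)).pairCount
      + 2 * ∑ v ∈ Sᶜ, ∑ u, G.adjInd v u := by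
  have h1 : (G.comap (Subtype.val : S → V)).pairCount = ∑ u ∈ S, ∑ v ∈ S, G.adjInd u v := by
    rw [← sum_coe_sort S]
    exact sum_congr rfl fun u _ ↦ (sum_coe_sort S (fun v ↦ G.adjInd u v))
  have h2 : ∑ u ∈ S, ∑ v ∈ Sᶜ, G.adjInd u v ≤ ∑ v ∈ Sᶜ, ∑ u, G.adjInd v u := by
    rw [sum_comm]
    refine sum_le_sum fun v _ ↦ ?_
    calc ∑ u ∈ S, G.adjInd u v = ∑ u ∈ S, G.adjInd v u :=
          sum_congr rfl fun u _ ↦ G.adjInd_comm u v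
      _ ≤ _ := sum_le_sum_of_subset_of_nonneg (subset_univ _) fun u _ _ ↦ G.adjInd_nonneg v u
  have h3 : ∑ u ∈ S, ∑ v, G.adjInd u v
      = ∑ u ∈ S, ∑ v ∈ S, G.adjInd u v + ∑ u ∈ S, ∑ v ∈ Sᶜ, G.adjInd u v := by
    rw [← sum_add_distrib]
    exact sum_congr rfl fun u _ ↦ (sum_add_sum_compl S _).symm
  rw [pairCount, ← sum_add_sum_compl S, h1, h3]
  linarith

theorem sum_adjInd_sub_card_le (S : Finset V) (v : V) :
    ∑ u, G.adjInd v u - #Sᶜ ≤ ∑ u ∈ S, G.adjInd v u := by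
  rw [← sum_add_sum_compl S]
  have : ∑ u ∈ Sᶜ, G.adjInd v u ≤ ∑ u ∈ Sᶜ, (1 : ℝ) := sum_le_sum fun u _ ↦ G.adjInd_le_one v u
  simp only [sum_const, nsmul_eq_mul, mul_one] at this
  linarith

end Induced

/-- A nearly extremal graph has few vertices of low degree. -/
theorem exists_card_lowDegree_le {r : ℕ} (hr : 0 < r) (s : ℕ) {δ' : ℝ} (hδ' : 0 < δ') :
    ∃ δ : ℝ, 0 < δ ∧ ∃ N : ℕ, ∀ (V : Type u) [Fintype V] (G : SimpleGraph V),
      N ≤ Fintype.card V → (completeEquipartiteGraph (r + 1) s).Free G →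
      (1 - 1 / (r : ℝ) - δ) * (Fintype.card V : ℝ) ^ 2 ≤ G.pairCount →
      ∀ B : Finset V,
        (∀ v ∈ B, ∑ u, G.adjInd v u < (1 - 1 / (r : ℝ) - δ') * Fintype.card V) →
        (#B : ℝ) ≤ δ' * Fintype.card V := by
  classical
  obtain ⟨C, hC⟩ := exists_pairCount_le_of_free.{u} (ε := δ' ^ 2 / 8) (by positivity) hr s
  have hr' : 1 / (r : ℝ) ≤ 1 := by
    rw [div_le_one (by positivity)]; exact_mod_cast hr
  have hr0 : 0 < 1 / (r : ℝ) := by positivity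
  set c := 1 - 1 / (r : ℝ)
  have hc0 : 0 ≤ c := by linarith
  have hc1 : c ≤ 1 := by linarith
  obtain ⟨N, hN⟩ := exists_nat_ge (16 * (2 + δ' ^ 2 + |C|) / δ' ^ 2)
  rw [div_le_iff₀ (by positivity)] at hN
  refine ⟨δ' ^ 2 / 4, by positivity, max N 1, fun V _ G hV hG hD B hB ↦ ?_⟩
  set n := Fintype.card V
  have hn1 : (1 : ℝ) ≤ n := by exact_mod_cast le_of_max_le_right hV
  have hNn : (N : ℝ) ≤ n := by exact_mod_cast le_of_max_le_left hV
  by_contra! hlt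
  -- Only about `δ' n` low-degree vertices are removed, so that `b - δ' n` is at most 1. Erdős–Stone
  -- on the remainder then loses about `δ'² n²` pairs overall, as the identity `hexp` shows.
  obtain ⟨B', hB'B, hB'⟩ := exists_subset_card_eq
    (Nat.ceil_le.mpr hlt.le : ⌈δ' * (n : ℝ)⌉₊ ≤ #B)
  have hb1 : δ' * n ≤ #B' := by rw [hB']; exact Nat.le_ceil _
  have hb2 : (#B' : ℝ) < δ' * n + 1 := by rw [hB']; exact Nat.ceil_lt_add_one (by positivity)
  have hcardS : (Fintype.card (B'ᶜ : Finset V) : ℝ) = n - #B' := by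
    rw [Fintype.card_coe, card_compl, Nat.cast_sub (card_le_univ B')]
  have h1 := G.pairCount_le_pairCount_comap_add B'ᶜ
  rw [compl_compl] at h1
  have h2 := hC _ (G.comap (Subtype.val : (B'ᶜ : Finset V) → V))
    fun h ↦ hG (h.trans (G.comap_val_isContained _))
  rw [hcardS] at h2
  have h3 : ∑ v ∈ B', ∑ u, G.adjInd v u ≤ ∑ _v ∈ B', (c - δ') * n :=
    sum_le_sum fun v hv ↦ (hB v (hB'B hv)).le
  rw [sum_const, nsmul_eq_mul] at h3
  set b : ℝ := (#B' : ℝ)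
  have hb0 : 0 ≤ b := by simp only [b]; positivity
  have hbn : b ≤ n := by simp only [b, n]; exact_mod_cast card_le_univ B'
  have h4 : (δ' ^ 2 / 8) * ((n - b) * (n - b + 1)) ≤ (δ' ^ 2 / 8) * (n * (n + 1)) := by
    gcongr <;> linarith
  have h5 : c * (n - b) ≤ 1 * n := by
    apply mul_le_mul hc1 (by linarith) (by linarith) zero_le_one
  have h6 : c * b ^ 2 ≤ 1 * b ^ 2 := by gcongr
  have h7 : (b - δ' * n) ^ 2 ≤ 1 := by
    rw [sq_le_one_iff₀ (by linarith)]; linarith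
  have h8 := le_abs_self C
  have h9 : 16 * (2 + δ' ^ 2 + |C|) * n ≤ n * δ' ^ 2 * n := by
    exact mul_le_mul_of_nonneg_right (hN.trans (by gcongr)) (by linarith)
  have h10 : |C| ≤ |C| * n := le_mul_of_one_le_right (abs_nonneg C) hn1
  have h11 : 0 ≤ |C| * n := by positivity
  have h12 : 0 < δ' ^ 2 * n := by positivity
  have h13 : 0 < δ' ^ 2 * n ^ 2 := by positivity
  have hfinal : (c - δ' ^ 2 / 4) * n ^ 2 ≤ c * (n - b) ^ 2 + 1 * n + (δ' ^ 2 / 8) * (n * (n + 1))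
      + C + 2 * (b * ((c - δ') * n)) := by
    have : (c + δ' ^ 2 / 8) * ((n - b) * (n - b + 1)) = c * (n - b) ^ 2 + c * (n - b)
      + (δ' ^ 2 / 8) * ((n - b) * (n - b + 1)) := by ring
    linarith
  have hexp : c * (n - b) ^ 2 + 2 * (b * ((c - δ') * n))
      = c * n ^ 2 + c * b ^ 2 - b ^ 2 + ((b - δ' * n) ^ 2 - δ' ^ 2 * n ^ 2) := by ring
  nlinarith

/-- A nearly extremal graph contains a complete equipartite graph on vertices of high degree. -/
theorem exists_copy_highDegree {r : ℕ} (hr : 0 < r) (s t : ℕ) {δ' : ℝ} (hδ' : 0 < δ')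
    (hδr : 1 / ((r + 1 : ℕ) : ℝ) + 2 * δ' < 1 / r) :
    ∃ δ : ℝ, 0 < δ ∧ ∃ N : ℕ, ∀ (V : Type u) [Fintype V] (G : SimpleGraph V),
      N ≤ Fintype.card V → (completeEquipartiteGraph (r + 1 + 1) s).Free G →
      (1 - 1 / ((r + 1 : ℕ) : ℝ) - δ) * (Fintype.card V : ℝ) ^ 2 ≤ G.pairCount →
      ∃ f : Copy (completeEquipartiteGraph (r + 1) t) G, ∀ x,
        (1 - 1 / ((r + 1 : ℕ) : ℝ) - δ') * Fintype.card V ≤ ∑ u, G.adjInd (f x) u := by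
  classical
  obtain ⟨δ, hδ, N₁, hN₁⟩ := exists_card_lowDegree_le.{u} (Nat.succ_pos r) s hδ'
  obtain ⟨N₂, hN₂⟩ := exists_completeEquipartiteGraph_isContained_of_le_degree.{u}
    -- This turns the degree threshold into `1 - 1 / (r + 1) - 2δ'`: one `δ'` for the degree
    -- deficit, one for neighbours lost in `B`.
    (ε := 1 / r - (1 / ((r + 1 : ℕ) : ℝ) + 2 * δ')) (by linarith) r t
  refine ⟨δ, hδ, max N₁ (2 * N₂), fun V _ G hV hG hD ↦ ?_⟩
  set c := 1 - 1 / ((r + 1 : ℕ) : ℝ)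
  set n := Fintype.card V
  set B : Finset V := {v | ∑ u, G.adjInd v u < (c - δ') * n} with hBdef
  have hB := hN₁ V G (le_of_max_le_left hV) hG hD B (fun v hv ↦ (mem_filter.mp hv).2)
  set S := Bᶜ
  have hcardS : (Fintype.card S : ℝ) = n - #B := by
    rw [Fintype.card_coe, card_compl, Nat.cast_sub (card_le_univ B)]
  have hr1 : 1 / (r : ℝ) ≤ 1 := by
    rw [div_le_one (by positivity)]; exact_mod_cast hr
  have hr0 : 0 < 1 / ((r + 1 : ℕ) : ℝ) := by positivity
  have hδhalf : δ' ≤ 1 / 2 := by linarith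
  have hn2 : ((2 * N₂ : ℕ) : ℝ) ≤ n := by exact_mod_cast le_of_max_le_right hV
  have hn0 : (0 : ℝ) ≤ n := Nat.cast_nonneg _
  have hN₂S : N₂ ≤ Fintype.card S := by
    have h1 : δ' * n ≤ 1 / 2 * n := by gcongr
    push_cast at hn2
    have : (N₂ : ℝ) ≤ Fintype.card S := by rw [hcardS]; linarith
    exact_mod_cast this
  have hcS : (Fintype.card S : ℝ) ≤ n := by
    rw [hcardS]; linarith [(Nat.cast_nonneg (#B) : (0 : ℝ) ≤ #B)]
  have hdeg : ∀ v : S, (1 - 1 / (r : ℝ) + (1 / r - (1 / ((r + 1 : ℕ) : ℝ) + 2 * δ')))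
      * Fintype.card S ≤ ∑ u, (G.comap (Subtype.val : S → V)).adjInd v u := by
    intro v
    have h1 : ∑ u, (G.comap (Subtype.val : S → V)).adjInd v u = ∑ u ∈ S, G.adjInd v u :=
      sum_coe_sort S (fun u ↦ G.adjInd v u)
    have h2 := G.sum_adjInd_sub_card_le S v
    rw [show Sᶜ = B from compl_compl B] at h2
    have h3 : (c - δ') * n ≤ ∑ u, G.adjInd v u := by
      have := v.2
      simp only [S, hBdef, mem_compl, mem_filter, mem_univ, true_and, not_lt] at this
      exact this
    rw [h1]
    have h4 : 0 ≤ c - 2 * δ' := by simp only [c]; linarith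
    calc _ = (c - 2 * δ') * Fintype.card S := by simp only [c]; ring
      _ ≤ (c - 2 * δ') * n := by gcongr
      _ ≤ _ := by linarith
  obtain ⟨g⟩ := hN₂ S (G.comap Subtype.val) hN₂S hdeg
  refine ⟨(⟨⟨Subtype.val, fun h ↦ h⟩, Subtype.val_injective⟩ :
    Copy (G.comap (Subtype.val : S → V)) G).comp g, fun x ↦ ?_⟩
  have := (g x).2
  simp only [S, hBdef, mem_compl, mem_filter, mem_univ, true_and, not_lt] at this
  exact this

/-! ### Neighbourhoods relative to a fixed equipartite subgraph. -/

section Neighbourhoods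

variable {V : Type u} {G : SimpleGraph V} {k s t : ℕ}

open Classical in
/-- The number of non-neighbours of `v` in the `i`-th part of a complete equipartite subgraph. -/
noncomputable def coDegree (f : Copy (completeEquipartiteGraph k t) G) (v : V) (i : Fin k) : ℕ :=
  #{j | ¬ G.Adj v (f (i, j))}

open Classical in
theorem card_filter_adj_eq (f : Copy (completeEquipartiteGraph k t) G) (v : V) (i : Fin k) :
    #{j | G.Adj v (f (i, j))} + coDegree f v i = t := by
  rw [coDegree, card_filter_add_card_filter_not, card_univ, Fintype.card_fin]

open Classical in
/-- Few vertices have many neighbours in every part. -/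
theorem card_filter_coDegree_le [Fintype V] (f : Copy (completeEquipartiteGraph k t) G)
    (hG : (completeEquipartiteGraph (k + 1) s).Free G) :
    #{v | ∀ i, coDegree f v i + s ≤ t} ≤ 2 ^ (k * t) * s := by
  by_contra! hlt
  set bad : Finset V := {v | ∀ i, coDegree f v i + s ≤ t} with hbad
  -- Pigeonhole over the `2 ^ (k * t)` possible neighbourhoods in the copy: more than `s` vertices
  -- share one, and it meets every part in at least `s` vertices, so these vertices form an extra
  -- part.
  obtain ⟨T, -, hT⟩ := exists_lt_card_fiber_of_mul_lt_card_of_maps_to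
    (s := bad) (t := (univ : Finset (Finset (Fin k × Fin t))))
    (f := fun v ↦ ({x | G.Adj v (f x)} : Finset (Fin k × Fin t))) (n := s)
    (fun _ _ ↦ mem_univ _) (by simpa using hlt)
  refine hG (completeEquipartiteGraph_isContained_of_family (ι := Option (Fin k)) (by simp)
    (fun o ↦ o.elim {v ∈ bad | ({x | G.Adj v (f x)} : Finset (Fin k × Fin t)) = T}
      (fun i ↦ {x ∈ T | x.1 = i}.image f)) ?_ ?_)
  · rintro (_ | i)
    · exact hT.le
    · obtain ⟨v, hv⟩ := card_pos.mp (Nat.zero_lt_of_lt hT)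
      obtain ⟨hvb, rfl⟩ := mem_filter.mp hv
      have h1 := (mem_filter.mp hvb).2 i
      have h2 := card_filter_adj_eq f v i
      simp only [Option.elim]
      rw [card_image_of_injective _ (show Function.Injective f from f.injective)]
      calc s ≤ #{j | G.Adj v (f (i, j))} := by omega
        _ ≤ _ := card_le_card_of_injOn (fun j ↦ (i, j)) (fun j hj ↦ by simpa using hj)
          (fun a _ b _ h ↦ by simpa using h)
  · have key : ∀ v x, (v ∈ bad ∧ ({x | G.Adj v (f x)} : Finset (Fin k × Fin t)) = T) → x ∈ T →
        G.Adj v (f x) := by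
      rintro v x ⟨-, rfl⟩ hx
      simpa using hx
    rintro (_ | i) (_ | j) hij u hu v hv
    · exact absurd rfl hij
    · simp only [Option.elim, mem_filter, mem_image] at hu hv
      obtain ⟨x, ⟨hx, -⟩, rfl⟩ := hv
      exact key u x hu hx
    · simp only [Option.elim, mem_filter, mem_image] at hu hv
      obtain ⟨x, ⟨hx, -⟩, rfl⟩ := hu
      exact (key v x hv hx).symm
    · simp only [Option.elim, mem_filter, mem_image] at hu hv
      obtain ⟨x, ⟨-, hx⟩, rfl⟩ := hu
      obtain ⟨y, ⟨-, hy⟩, rfl⟩ := hv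
      refine f.toHom.map_adj ?_
      rw [completeEquipartiteGraph_adj, hx, hy]
      exact fun h ↦ hij (congrArg some h)

/-- The edges of `G` inside `T` joining vertices with the same value of `p`. -/
def innerGraph {ι : Type*} (G : SimpleGraph V) (p : V → ι) (T : Finset V) : SimpleGraph V where
  Adj u v := G.Adj u v ∧ u ∈ T ∧ v ∈ T ∧ p u = p v
  symm := ⟨fun _ _ h ↦ ⟨h.1.symm, h.2.2.1, h.2.1, h.2.2.2.symm⟩⟩
  loopless := ⟨fun _ h ↦ G.irrefl h.1⟩

/-- If all vertices of `T` are joined to almost all of every part but their own, then the parts of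
`T` span no large complete bipartite graph. -/
theorem innerGraph_free (f : Copy (completeEquipartiteGraph k t) G)
    (hG : (completeEquipartiteGraph (k + 1) s).Free G) (hs : 0 < s) (p : V → Fin k) (T : Finset V)
    {b : ℕ} (hb : 2 * s * b + s ≤ t) (hT : ∀ v ∈ T, ∀ j, j ≠ p v → coDegree f v j ≤ b) :
    (completeEquipartiteGraph 2 s).Free (G.innerGraph p T) := by
  classical
  rintro ⟨g⟩
  have hadj (i j : Fin s) : (G.innerGraph p T).Adj (g (0, i)) (g (1, j)) :=
    g.toHom.map_adj (by rw [completeEquipartiteGraph_adj]; simp)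
  set i₀ := p (g (0, ⟨0, hs⟩))
  have hp1 (j : Fin s) : p (g (1, j)) = i₀ := (hadj ⟨0, hs⟩ j).2.2.2.symm
  have hp0 (i : Fin s) : p (g (0, i)) = i₀ := (hadj i ⟨0, hs⟩).2.2.2.trans (hp1 _)
  have hp (x : Fin 2 × Fin s) : p (g x) = i₀ ∧ g x ∈ T := by
    obtain ⟨a, i⟩ := x
    fin_cases a
    · exact ⟨hp0 i, (hadj i i).2.1⟩
    · exact ⟨hp1 i, (hadj i i).2.2.1⟩
  set P : Fin 2 → Finset V := fun a ↦ univ.image fun i ↦ g (a, i)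
  -- The common neighbours of the bipartite graph in part `j`. Each of its `2s` vertices excludes at
  -- most `b` points when `j ≠ i₀`, so `s` remain. The two sides replace part `i₀`, which raises the
  -- number of parts to `k + 1`.
  set Q : Fin k → Finset V := fun j ↦
    ({i | ∀ x, G.Adj (g x) (f (j, i))} : Finset (Fin t)).image fun i ↦ f (j, i)
  have hP (a) : #(P a) = s := by
    rw [card_image_of_injective _ fun i j h ↦ by simpa using g.injective h]
    simp
  have hQ (j) (hj : j ≠ i₀) : s ≤ #(Q j) := by
    rw [card_image_of_injective _ fun i j h ↦ by simpa using f.injective h]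
    have h1 : #({i | ¬ ∀ x, G.Adj (g x) (f (j, i))} : Finset (Fin t)) ≤ 2 * s * b := by
      calc _ ≤ #((univ : Finset (Fin 2 × Fin s)).biUnion fun x ↦
              ({i | ¬ G.Adj (g x) (f (j, i))} : Finset (Fin t))) := by
            refine card_le_card fun i hi ↦ ?_
            simpa only [mem_biUnion, mem_filter, mem_univ, true_and, not_forall] using hi
        _ ≤ ∑ x : Fin 2 × Fin s, coDegree f (g x) j := card_biUnion_le
        _ ≤ ∑ _x : Fin 2 × Fin s, b :=
            sum_le_sum fun x _ ↦ hT _ (hp x).2 _ (by rwa [(hp x).1])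
        _ = 2 * s * b := by simp
    have h2 := card_filter_add_card_filter_not (s := (univ : Finset (Fin t)))
      (fun i ↦ ∀ x, G.Adj (g x) (f (j, i)))
    rw [card_univ, Fintype.card_fin] at h2
    omega
  have hPP : ∀ u ∈ P 0, ∀ v ∈ P 1, G.Adj u v := by
    intro u hu v hv
    obtain ⟨i, -, rfl⟩ := mem_image.mp hu
    obtain ⟨j, -, rfl⟩ := mem_image.mp hv
    exact (hadj i j).1
  have hPQ : ∀ a j, ∀ u ∈ P a, ∀ v ∈ Q j, G.Adj u v := by
    intro a j u hu v hv
    obtain ⟨i, -, rfl⟩ := mem_image.mp hu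
    obtain ⟨l, hl, rfl⟩ := mem_image.mp hv
    exact (mem_filter.mp hl).2 _
  have hQQ : ∀ i j, i ≠ j → ∀ u ∈ Q i, ∀ v ∈ Q j, G.Adj u v := by
    intro i j hij u hu v hv
    obtain ⟨a, -, rfl⟩ := mem_image.mp hu
    obtain ⟨b, -, rfl⟩ := mem_image.mp hv
    exact f.toHom.map_adj hij
  refine hG (completeEquipartiteGraph_isContained_of_family (ι := Option (Fin k)) (by simp)
    (fun o ↦ o.elim (P 0) (fun j ↦ if j = i₀ then P 1 else Q j)) ?_ ?_)
  · rintro (_ | j)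
    · exact (hP 0).ge
    · simp only [Option.elim]
      split_ifs with h
      · exact (hP 1).ge
      · exact hQ j h
  · rintro (_ | i) (_ | j) hij u hu v hv
    · exact absurd rfl hij
    · simp only [Option.elim] at hu hv
      split_ifs at hv
      · exact hPP u hu v hv
      · exact hPQ 0 j u hu v hv
    · simp only [Option.elim] at hu hv
      split_ifs at hu
      · exact (hPP v hv u hu).symm
      · exact (hPQ 0 i v hv u hu).symm
    · simp only [Option.elim] at hu hv
      split_ifs at hu hv with h1 h2 h2
      · exact absurd (by rw [h1, h2]) hij
      · exact hPQ 1 j u hu v hv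
      · exact (hPQ 1 i v hv u hu).symm
      · exact hQQ i j (fun h ↦ hij (congrArg some h)) u hu v hv

end Neighbourhoods

section Inner

variable {V : Type u} {G : SimpleGraph V} {k s t : ℕ}

theorem sum_coDegree_eq (f : Copy (completeEquipartiteGraph k t) G) (v : V) :
    ((∑ i, coDegree f v i : ℕ) : ℝ) = ∑ x, (1 - G.adjInd v (f x)) := by
  classical
  rw [Fintype.sum_prod_type, Nat.cast_sum]
  refine sum_congr rfl fun i _ ↦ ?_
  rw [coDegree, ← sum_boole]
  refine sum_congr rfl fun j _ ↦ ?_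
  by_cases h : G.Adj v (f (i, j)) <;> simp [adjInd, h]

open Classical in
/-- Few vertices miss noticeably more than one part of a complete equipartite subgraph on vertices
of high degree. -/
theorem card_filter_le_sum_coDegree_mul_le [Fintype V] (hk : 0 < k)
    (f : Copy (completeEquipartiteGraph k t) G)
    {δ' : ℝ} (hf : ∀ x, (1 - 1 / (k : ℝ) - δ') * Fintype.card V ≤ ∑ u, G.adjInd (f x) u) (w : ℕ) :
    (#{v | t + w ≤ ∑ i, coDegree f v i} : ℝ) * w ≤ (s + k * t * δ') * Fintype.card V
      + t * #{v | ∀ i, coDegree f v i + s ≤ t} := by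
  set n : ℝ := (Fintype.card V : ℝ)
  have hk0 : (k : ℝ) ≠ 0 := by positivity
  -- Double counting of missing pairs: high degrees in the copy bound the average over `v` by about
  -- `t`, while every vertex outside the exceptional set misses at least `t - s`. Hence few vertices
  -- can miss `t + w`.
  have hup : ∑ v, ∑ x, (1 - G.adjInd v (f x)) ≤ k * t * ((1 / k + δ') * n) := by
    rw [sum_comm]
    calc _ ≤ ∑ _x : Fin k × Fin t, ((1 / (k : ℝ) + δ') * n) := by
          refine sum_le_sum fun x _ ↦ ?_
          have h1 : ∑ v, (1 - G.adjInd v (f x)) = n - ∑ u, G.adjInd (f x) u := by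
            rw [sum_sub_distrib]
            congr 1
            · simp [n]
            · exact sum_congr rfl fun v _ ↦ G.adjInd_comm _ _
          have h2 := hf x
          rw [h1]
          simp only [n] at h2 ⊢
          linarith
      _ = _ := by simp
  have hlow : ∀ v, ((t : ℝ) - s) - t * (if ∀ i, coDegree f v i + s ≤ t then 1 else 0)
      + w * (if t + w ≤ ∑ i, coDegree f v i then 1 else 0) ≤ ∑ x, (1 - G.adjInd v (f x)) := by
    intro v
    rw [← sum_coDegree_eq]
    have hs0 : (0 : ℝ) ≤ s := by positivity
    have ht0 : (0 : ℝ) ≤ t := by positivity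
    have hS0 : (0 : ℝ) ≤ ((∑ i, coDegree f v i : ℕ) : ℝ) := by positivity
    by_cases h2 : t + w ≤ ∑ i, coDegree f v i
    · have h2' : ((t + w : ℕ) : ℝ) ≤ ((∑ i, coDegree f v i : ℕ) : ℝ) := by exact_mod_cast h2
      rw [if_pos h2]
      push_cast at h2' ⊢
      split_ifs <;> linarith
    · rw [if_neg h2]
      by_cases h1 : ∀ i, coDegree f v i + s ≤ t
      · rw [if_pos h1]; linarith
      · rw [if_neg h1]
        push Not at h1
        obtain ⟨i, hi⟩ := h1
        have h3 : coDegree f v i ≤ ∑ i, coDegree f v i :=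
          single_le_sum (f := fun i ↦ coDegree f v i) (fun _ _ ↦ Nat.zero_le _) (mem_univ i)
        have h4 : (t : ℝ) ≤ ((∑ i, coDegree f v i : ℕ) : ℝ) + s := by
          exact_mod_cast (by omega : t ≤ ∑ i, coDegree f v i + s)
        linarith
  have hsum := (sum_le_sum fun v (_ : v ∈ univ) ↦ hlow v).trans hup
  rw [sum_add_distrib, sum_sub_distrib, ← mul_sum, ← mul_sum, sum_boole, sum_boole, sum_const,
    card_univ, nsmul_eq_mul] at hsum
  have hkt : (k : ℝ) * t * ((1 / k + δ') * n) = t * n + k * t * δ' * n := by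
    field_simp
  rw [hkt] at hsum
  simp only [n] at hsum ⊢
  linarith

open Classical in
theorem sum_ite_eq_le_pairCount_innerGraph [Fintype V] {ι : Type*} [DecidableEq ι] (p : V → ι) (T : Finset V) :
    ∑ u, ∑ v, (if p u = p v then G.adjInd u v else 0)
      ≤ (G.innerGraph p T).pairCount + 2 * Fintype.card V * #Tᶜ := by
  have h1 : ∀ u v, (if p u = p v then G.adjInd u v else 0)
      ≤ (G.innerGraph p T).adjInd u v + (if u ∈ Tᶜ then 1 else 0) + (if v ∈ Tᶜ then 1 else 0) := by
    intro u v
    have := G.adjInd_le_one u v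
    have h0 := (G.innerGraph p T).adjInd_nonneg u v
    by_cases hu : u ∈ T <;> by_cases hv : v ∈ T
    · by_cases hp : p u = p v
      · have : G.adjInd u v = (G.innerGraph p T).adjInd u v := by
          simp [adjInd, innerGraph, hu, hv, hp]
        simp [hu, hv, hp, this]
      · simp [hu, hv, hp, h0]
    all_goals
      simp only [mem_compl, hu, hv, not_true_eq_false, not_false_eq_true, if_true, if_false]
      split_ifs <;> linarith
  have h2 : ∑ v, (if v ∈ Tᶜ then (1 : ℝ) else 0) = #Tᶜ := by rw [sum_boole, filter_univ_mem]
  calc _ ≤ ∑ u, ∑ v, ((G.innerGraph p T).adjInd u v + (if u ∈ Tᶜ then 1 else 0)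
        + (if v ∈ Tᶜ then 1 else 0)) := sum_le_sum fun u _ ↦ sum_le_sum fun v _ ↦ h1 u v
    _ = (G.innerGraph p T).pairCount + 2 * Fintype.card V * #Tᶜ := by
      simp only [sum_add_distrib, sum_const, nsmul_eq_mul, card_univ, pairCount, ← mul_sum, h2]
      ring

end Inner

/-- The vertices of a nearly extremal graph can be partitioned into `r + 1` parts spanning few
edges. -/
theorem exists_partition_few_inner {r : ℕ} (hr : 0 < r) {s : ℕ} (hs : 0 < s) {η : ℝ} (hη : 0 < η) :
    ∃ δ : ℝ, 0 < δ ∧ ∃ N : ℕ, ∀ (V : Type u) [Fintype V] (G : SimpleGraph V),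
      N ≤ Fintype.card V → (completeEquipartiteGraph (r + 1 + 1) s).Free G →
      (1 - 1 / ((r + 1 : ℕ) : ℝ) - δ) * (Fintype.card V : ℝ) ^ 2 ≤ G.pairCount →
      ∃ p : V → Fin (r + 1), ∑ u, ∑ v, (if p u = p v then G.adjInd u v else 0)
        ≤ η * (Fintype.card V : ℝ) ^ 2 := by
  classical
  set μ := η / 16
  have hμ : 0 < μ := by positivity
  obtain ⟨w₀, hw₀⟩ := exists_nat_ge (s / μ)
  rw [div_le_iff₀ hμ] at hw₀
  obtain ⟨w, hw⟩ : ∃ w, w = w₀ + s + 1 := ⟨_, rfl⟩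
  -- Since `w > s`, this gives `2s(w + s) + s ≤ t`, as `innerGraph_free` needs with `b = w + s`.
  obtain ⟨t, htw⟩ : ∃ t, t = 4 * s * w := ⟨_, rfl⟩
  have ht : 0 < t := by rw [htw, hw]; positivity
  obtain ⟨k, hk⟩ : ∃ k, k = r + 1 := ⟨_, rfl⟩
  have hk0 : 0 < k := by omega
  have : NeZero k := ⟨hk0.ne'⟩
  rw [← hk]
  have hgap : 0 < 1 / (r : ℝ) - 1 / (k : ℝ) := by
    rw [sub_pos]
    apply one_div_lt_one_div_of_lt (by positivity)
    rw [hk]; push_cast; linarith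
  set δ' := min (μ / (k * t)) ((1 / (r : ℝ) - 1 / (k : ℝ)) / 4)
  have hδ' : 0 < δ' := by positivity
  have hδ'1 : k * t * δ' ≤ μ := by
    have : δ' ≤ μ / (k * t) := min_le_left _ _
    rwa [le_div_iff₀ (by positivity), mul_comm] at this
  have hδ'2 : δ' ≤ (1 / (r : ℝ) - 1 / (k : ℝ)) / 4 := min_le_right _ _
  obtain ⟨δ, hδ, N₁, hN₁⟩ := exists_copy_highDegree.{u} hr s t hδ' (by rw [← hk]; linarith)
  rw [← hk] at hN₁
  obtain ⟨N₂, hN₂⟩ := exists_pairCount_le_sq_of_free.{u} (half_pos hη) one_pos s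
  obtain ⟨M, hM⟩ : ∃ M, M = 2 ^ (k * t) * s := ⟨_, rfl⟩
  obtain ⟨N₃, hN₃⟩ := exists_nat_ge ((t + 1) * M / μ)
  rw [div_le_iff₀ hμ] at hN₃
  refine ⟨δ, hδ, max N₁ (max N₂ N₃), fun V _ G hV hG hD ↦ ?_⟩
  obtain ⟨f, hf⟩ := hN₁ V G (le_of_max_le_left hV) hG hD
  set n := Fintype.card V
  have hbad := card_filter_coDegree_le f hG
  rw [← hM] at hbad
  have hmany := card_filter_le_sum_coDegree_mul_le (s := s) hk0 f hf w
  set bad : Finset V := {v | ∀ i, coDegree f v i + s ≤ t}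
  set many : Finset V := {v | t + w ≤ ∑ i, coDegree f v i}
  set T := (bad ∪ many)ᶜ
  -- A vertex goes to a part that it misses almost entirely. The default 0 occurs only for vertices
  -- of `bad`, which lie outside `T`.
  set p : V → Fin k := fun v ↦
    if h : ∃ i, t < coDegree f v i + s then h.choose else 0
  have hT : ∀ v ∈ T, ∀ j, j ≠ p v → coDegree f v j ≤ w + s := by
    intro v hv j hj
    simp only [T, bad, many, mem_compl, mem_union, mem_filter, mem_univ, true_and, not_or,
      not_forall, not_le] at hv
    have hp : t < coDegree f v (p v) + s := by
      simp only [p, dif_pos hv.1]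
      exact hv.1.choose_spec
    -- Part `p v` uses more than `t - s` of a total below `t + w`, so any other part has less than
    -- `w + s`.
    have h1 : coDegree f v j + coDegree f v (p v) ≤ ∑ i, coDegree f v i := by
      rw [← sum_pair hj]
      exact sum_le_sum_of_subset (subset_univ _)
    omega
  have hfree := innerGraph_free f hG hs p T (b := w + s) (by rw [htw, hw]; ring_nf; omega) hT
  refine ⟨p, (sum_ite_eq_le_pairCount_innerGraph p T).trans ?_⟩
  have h1 := hN₂ V _ (le_of_max_le_left (le_of_max_le_right hV)) hfree
  have hn3 : (N₃ : ℝ) ≤ n := by exact_mod_cast le_of_max_le_right (le_of_max_le_right hV)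
  have hn0 : (0 : ℝ) ≤ n := Nat.cast_nonneg _
  have hbadR : (#bad : ℝ) ≤ M := by exact_mod_cast hbad
  have hM0 : (0 : ℝ) ≤ M := by positivity
  have hw1 : (1 : ℝ) ≤ w := by rw [hw]; push_cast; linarith [(by positivity : (0 : ℝ) ≤ (w₀ : ℝ) + s)]
  have hwμ : (s : ℝ) ≤ w * μ := hw₀.trans (by gcongr; omega)
  have hmanyR : (#many : ℝ) ≤ 2 * μ * n + t * M := by
    have h2 : (#many : ℝ) * w ≤ (2 * μ * n + t * M) * w := by
      have e1 : (s + k * t * δ') * (n : ℝ) ≤ (w * μ + w * μ) * n :=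
        mul_le_mul_of_nonneg_right
          (add_le_add hwμ (hδ'1.trans (le_mul_of_one_le_left hμ.le hw1))) hn0
      have e2 : (t : ℝ) * #bad ≤ t * M * w :=
        (mul_le_mul_of_nonneg_left hbadR (by positivity)).trans
          (le_mul_of_one_le_right (by positivity) hw1)
      linarith
    exact le_of_mul_le_mul_right h2 (by linarith)
  have hTc : (#Tᶜ : ℝ) ≤ 3 * μ * n := by
    have h2 : (#Tᶜ : ℝ) ≤ #bad + #many := by
      simp only [T, compl_compl]
      exact_mod_cast card_union_le _ _
    have h3 : (N₃ : ℝ) * μ ≤ n * μ := by gcongr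
    linarith
  have h4 : 2 * (n : ℝ) * #Tᶜ ≤ 2 * n * (3 * μ * n) := by gcongr
  have h5 : 0 ≤ η * (n : ℝ) ^ 2 := by positivity
  norm_num at h1
  simp only [μ] at h4
  linarith

/-! ### Matching a nearly balanced partition with residue classes. -/

theorem div_le_card_filter_mod_eq {n k : ℕ} (i : Fin k) :
    n / k ≤ #{x : Fin n | (x : ℕ) % k = i} := by
  rw [← Fintype.card_fin (n / k), ← card_univ]
  have hlt (j : Fin (n / k)) : (j : ℕ) * k + i < n := by
    have h1 : ((j : ℕ) + 1) * k ≤ n / k * k := Nat.mul_le_mul_right k j.2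
    have h2 := Nat.div_mul_le_self n k
    have h3 := i.2
    rw [add_mul, one_mul] at h1
    omega
  refine card_le_card_of_injOn (fun j ↦ ⟨j * k + i, hlt j⟩) (fun j _ ↦ ?_) fun a _ b _ h ↦ ?_
  · simp [Nat.mod_eq_of_lt i.2]
  · have hk : 0 < k := i.pos
    have h' : (a : ℕ) * k + i = b * k + i := congrArg Fin.val h
    exact Fin.ext (Nat.eq_of_mul_eq_mul_right hk (by omega))

section Balance

variable {V : Type*} [Fintype V] [DecidableEq V] {n k : ℕ}

/-- A partition with parts of size at most `n / k + d` agrees with a Turán partition outside a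
small set. -/
theorem exists_equiv_mod_eq (hV : Fintype.card V = n) (p : V → Fin k) {d : ℝ} (hd : 0 ≤ d)
    (hp : ∀ i, (#{v | p v = i} : ℝ) ≤ n / k + d) :
    ∃ (e : V ≃ Fin n) (S : Finset V), (#S : ℝ) ≤ k * (d + 1) ∧ ∀ v ∉ S, (e v : ℕ) % k = p v := by
  -- Keep as much of part `i` as its residue class can hold. The overflow is at most `d + 1`, with
  -- the 1 coming from rounding, so upper bounds on the parts suffice.
  have hA (i : Fin k) : ∃ A : Finset V, A ⊆ ({v | p v = i} : Finset V) ∧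
      #A = min #{v | p v = i} #{x : Fin n | (x : ℕ) % k = i} :=
    exists_subset_card_eq (min_le_left _ _)
  choose A hAp hAcard using hA
  have hemb (i : Fin k) : Nonempty (A i ↪ ({x : Fin n | (x : ℕ) % k = i} : Finset (Fin n))) := by
    rw [Function.Embedding.nonempty_iff_card_le]
    simp only [Fintype.card_coe, hAcard i]
    exact min_le_right _ _
  have φ (i : Fin k) := (hemb i).some
  have e₀ : V ≃ Fin n := Fintype.equivFinOfCardEq hV
  set f : V → Fin n := fun v ↦ if h : v ∈ A (p v) then (φ (p v) ⟨v, h⟩ : Fin n) else e₀ v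
  set R : Finset V := {v | v ∈ A (p v)}
  have hf : ∀ v ∈ R, (f v : ℕ) % k = p v := by
    intro v hv
    have h : v ∈ A (p v) := (mem_filter.mp hv).2
    simp only [f, dif_pos h]
    exact (mem_filter.mp (φ (p v) ⟨v, h⟩).2).2
  have hinj : Set.InjOn f R := by
    intro u hu v hv huv
    have hp : p u = p v := by
      have h1 := hf u hu
      have h2 := hf v hv
      rw [huv, h2] at h1
      exact (Fin.ext h1).symm
    have hu' : u ∈ A (p u) := (mem_filter.mp hu).2
    have hv' : v ∈ A (p v) := (mem_filter.mp hv).2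
    simp only [f, dif_pos hu', dif_pos hv'] at huv
    have key : ∀ i j (hij : i = j) (hi : u ∈ A i) (hj : v ∈ A j),
        (φ i ⟨u, hi⟩ : Fin n) = φ j ⟨v, hj⟩ → u = v := by
      rintro i _ rfl hi hj h
      exact congrArg Subtype.val ((φ i).injective (Subtype.ext h))
    exact key _ _ hp hu' hv' huv
  obtain ⟨g, hg⟩ := exists_equiv_extend_of_card_eq (t := (univ : Finset (Fin n)))
    (by simpa using hV) (subset_univ _) hinj
  refine ⟨g.trans (Equiv.subtypeUnivEquiv fun x ↦ mem_univ x), Rᶜ, ?_, fun v hv ↦ ?_⟩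
  · have h1 : #Rᶜ = ∑ i, #{v | v ∉ A i ∧ p v = i} := by
      rw [card_eq_sum_card_fiberwise (f := p) (t := univ) fun _ _ ↦ mem_univ _]
      refine sum_congr rfl fun i _ ↦ congrArg card ?_
      ext v
      simp only [R, mem_filter, mem_compl, mem_univ, true_and]
      constructor
      · rintro ⟨h, rfl⟩; exact ⟨h, rfl⟩
      · rintro ⟨h, rfl⟩; exact ⟨h, rfl⟩
    have h2 : ∀ i, (#{v | v ∉ A i ∧ p v = i} : ℝ) ≤ d + 1 := by
      intro i
      have h3 : ({v | v ∉ A i ∧ p v = i} : Finset V) = ({v | p v = i} : Finset V) \ A i := by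
        ext v; simp [and_comm]
      have h4 := div_le_card_filter_mod_eq (n := n) i
      have h5 : (n : ℝ) / k < (n / k : ℕ) + 1 := by
        have hk : (0 : ℝ) < k := by exact_mod_cast i.pos
        rw [div_lt_iff₀ hk]
        have h7 : n < (n / k + 1) * k := by
          rw [add_mul, one_mul]; exact Nat.lt_div_mul_add i.pos
        exact_mod_cast h7
      have h6 : ((n / k : ℕ) : ℝ) ≤ #{x : Fin n | (x : ℕ) % k = i} := by exact_mod_cast h4
      rw [h3, card_sdiff_of_subset (hAp i), hAcard i,
        Nat.cast_sub (min_le_left _ _), Nat.cast_min]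
      rcases min_cases (#{v | p v = i} : ℝ) (#{x : Fin n | (x : ℕ) % k = i} : ℝ) with h | h
      · rw [h.1]; linarith
      · rw [h.1]; linarith [hp i]
    rw [h1, Nat.cast_sum]
    calc _ ≤ ∑ _i : Fin k, (d + 1) := sum_le_sum fun i _ ↦ h2 i
      _ = _ := by rw [sum_const, card_univ, Fintype.card_fin, nsmul_eq_mul]
  · have hv' : v ∈ R := by simpa using hv
    have : (g.trans (Equiv.subtypeUnivEquiv fun x ↦ mem_univ x)) v = f v := hg v hv'
    rw [this]
    exact hf v hv'

end Balance

/-! ### Edit distance to the Turán graph. -/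

section Edits

variable {V : Type*} [Fintype V]

/-- The right side runs over ordered pairs, so each edge is counted twice; the lost factor 2 is
harmless. -/
theorem ncard_symmDiff_edgeSet_le (G H : SimpleGraph V) :
    ((symmDiff G.edgeSet H.edgeSet).ncard : ℝ)
      ≤ ∑ u, ∑ v, |G.adjInd u v - H.adjInd u v| := by
  classical
  set E : Finset (V × V) := {x | ¬ (G.Adj x.1 x.2 ↔ H.Adj x.1 x.2)}
  have hsub : symmDiff G.edgeSet H.edgeSet ⊆ (fun x : V × V ↦ s(x.1, x.2)) '' E := by
    intro e he
    induction e with | _ u v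
    refine ⟨(u, v), ?_, rfl⟩
    simp only [Set.mem_symmDiff, mem_edgeSet] at he
    simp only [E, coe_filter, mem_univ, true_and, Set.mem_ofPred_eq]
    tauto
  have h1 : (symmDiff G.edgeSet H.edgeSet).ncard ≤ #E := by
    refine (Set.ncard_le_ncard hsub (E.finite_toSet.image _)).trans ?_
    refine (Set.ncard_image_le E.finite_toSet).trans ?_
    rw [Set.ncard_coe_finset]
  have h2 : (#E : ℝ) = ∑ u, ∑ v, |G.adjInd u v - H.adjInd u v| := by
    rw [← Fintype.sum_prod_type', ← sum_boole]
    refine sum_congr rfl fun x _ ↦ ?_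
    by_cases hG : G.Adj x.1 x.2 <;> by_cases hH : H.Adj x.1 x.2 <;> simp [adjInd, hG, hH]
  rw [← h2]
  exact_mod_cast h1

theorem sum_sum_ite_eq_sum_sq {k : ℕ} (p : V → Fin k) :
    ∑ u, ∑ v, (if p u = p v then (1 : ℝ) else 0) = ∑ i, (#{v | p v = i} : ℝ) ^ 2 := by
  have h (u : V) : ∑ v, (if p u = p v then (1 : ℝ) else 0) = #{v | p v = p u} := by
    rw [sum_boole]; simp only [eq_comm]
  simp only [h]
  rw [← sum_fiberwise univ p]
  refine sum_congr rfl fun i _ ↦ ?_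
  rw [sum_congr rfl (g := fun _ ↦ (#{v | p v = i} : ℝ))
    fun v hv ↦ by rw [(mem_filter.mp hv).2]]
  rw [sum_const, nsmul_eq_mul, sq]

/-- A dense graph that is almost `k`-partite is close to the Turán graph. -/
theorem obtainedByEdits_turanGraph_of_partition {n k : ℕ} (hk : 0 < k)
    (hV : Fintype.card V = n) (G : SimpleGraph V) (p : V → Fin k) {δ η κ : ℝ}
    (hκ : 0 ≤ κ) (hδη : δ + η ≤ κ ^ 2)
    (hD : (1 - 1 / (k : ℝ) - δ) * (n : ℝ) ^ 2 ≤ G.pairCount)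
    (hin : ∑ u, ∑ v, (if p u = p v then G.adjInd u v else 0) ≤ η * (n : ℝ) ^ 2) :
    G.ObtainedByEdits (turanGraph n k) ((δ + 2 * η) * (n : ℝ) ^ 2 + 2 * n * (k * (κ * n + 1))) := by
  classical
  have hk0 : (0 : ℝ) < k := by exact_mod_cast hk
  set s : Fin k → ℝ := fun i ↦ (#{v | p v = i} : ℝ)
  have hs : ∑ i, s i = n := by
    have := card_eq_sum_card_fiberwise (s := (univ : Finset V)) (f := p) (t := univ)
      fun _ _ ↦ mem_univ _
    rw [card_univ, hV] at this
    rw [this, Nat.cast_sum]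
  have hcs : (n : ℝ) ^ 2 / k ≤ ∑ i, s i ^ 2 := by
    rw [div_le_iff₀' hk0]
    have := sq_sum_le_card_mul_sum_sq (s := (univ : Finset (Fin k))) (f := s)
    rwa [hs, card_univ, Fintype.card_fin] at this
  set miss := ∑ u, ∑ v, (if p u = p v then 0 else 1 - G.adjInd u v)
  -- This identity is used twice: Cauchy–Schwarz on the part sizes bounds `miss` from above, and
  -- `miss ≥ 0` bounds the variance of the part sizes, making each deviate by at most `κ n`.
  have hmiss : miss = (n : ℝ) ^ 2 - ∑ i, s i ^ 2 - G.pairCount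
      + ∑ u, ∑ v, (if p u = p v then G.adjInd u v else 0) := by
    have h1 : (n : ℝ) ^ 2 = ∑ _u : V, ∑ _v : V, (1 : ℝ) := by simp [hV, sq]
    rw [h1, ← sum_sum_ite_eq_sum_sq, pairCount]
    simp only [miss, ← sum_sub_distrib, ← sum_add_distrib]
    refine sum_congr rfl fun u _ ↦ sum_congr rfl fun v _ ↦ ?_
    split_ifs <;> ring
  have hmiss0 : 0 ≤ miss := by
    refine sum_nonneg fun u _ ↦ sum_nonneg fun v _ ↦ ?_
    split_ifs
    · exact le_rfl
    · exact sub_nonneg.mpr (G.adjInd_le_one u v)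
  have hdiv : 1 / (k : ℝ) * (n : ℝ) ^ 2 = (n : ℝ) ^ 2 / k := by ring
  have hmissle : miss ≤ (δ + η) * (n : ℝ) ^ 2 := by linarith
  have hdev (i : Fin k) : s i ≤ n / k + κ * n := by
    have h1 : ∑ i, (s i - n / k) ^ 2 = ∑ i, s i ^ 2 - (n : ℝ) ^ 2 / k := by
      have : ∀ i, (s i - n / k) ^ 2 = s i ^ 2 - 2 * (n / k) * s i + (n / k) ^ 2 := fun i ↦ by ring
      simp only [this, sum_add_distrib, sum_sub_distrib, ← mul_sum, hs, sum_const, card_univ,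
        Fintype.card_fin, nsmul_eq_mul]
      field_simp; ring
    have h2 : (s i - n / k) ^ 2 ≤ ∑ i, (s i - n / k) ^ 2 :=
      single_le_sum (f := fun i ↦ (s i - n / k) ^ 2) (fun _ _ ↦ sq_nonneg _) (mem_univ i)
    have h3 : (s i - n / k) ^ 2 ≤ (κ * n) ^ 2 := by
      have : (δ + η) * (n : ℝ) ^ 2 ≤ κ ^ 2 * (n : ℝ) ^ 2 := by gcongr
      rw [mul_pow]; linarith
    have := abs_le_of_sq_le_sq' h3 (by positivity)
    linarith [this.2]
  obtain ⟨e, S, hS, he⟩ := exists_equiv_mod_eq hV p (by positivity : 0 ≤ κ * n) hdev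
  refine ⟨(turanGraph n k).comap e, ⟨Iso.comap e _⟩, (ncard_symmDiff_edgeSet_le _ _).trans ?_⟩
  have hpt : ∀ u v, |G.adjInd u v - ((turanGraph n k).comap e).adjInd u v|
      ≤ (if p u = p v then G.adjInd u v else 0) + (if p u = p v then 0 else 1 - G.adjInd u v)
        + (if u ∈ S then 1 else 0) + (if v ∈ S then 1 else 0) := by
    intro u v
    have h0 := G.adjInd_nonneg u v
    have h1 := G.adjInd_le_one u v
    have h2 : |G.adjInd u v - ((turanGraph n k).comap e).adjInd u v| ≤ 1 := by
      have h3 := ((turanGraph n k).comap e).adjInd_nonneg u v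
      have h4 := ((turanGraph n k).comap e).adjInd_le_one u v
      rw [abs_le]
      constructor <;> linarith
    by_cases hu : u ∈ S
    · simp only [hu, if_true]; split_ifs <;> linarith
    by_cases hv : v ∈ S
    · simp only [hv, if_true]; split_ifs <;> linarith
    have hH : ((turanGraph n k).comap e).Adj u v ↔ p u ≠ p v := by
      rw [comap_adj, turanGraph_adj, he u hu, he v hv, not_iff_not]
      exact Fin.ext_iff.symm
    by_cases hp : p u = p v
    · rw [((turanGraph n k).comap e).adjInd_of_not_adj (by rw [hH]; exact not_not.mpr hp)]
      simp [hu, hv, hp, abs_of_nonneg h0]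
    · rw [((turanGraph n k).comap e).adjInd_of_adj (hH.mpr hp), abs_sub_comm, abs_of_nonneg (by linarith)]
      simp [hu, hv, hp]
  have hSsum : ∑ v, (if v ∈ S then (1 : ℝ) else 0) = #S := by rw [sum_boole, filter_univ_mem]
  have hedit : ∑ u, ∑ v, |G.adjInd u v - ((turanGraph n k).comap e).adjInd u v|
      ≤ ∑ u, ∑ v, (if p u = p v then G.adjInd u v else 0) + miss + 2 * n * #S := by
    refine (sum_le_sum fun u _ ↦ sum_le_sum fun v _ ↦ hpt u v).trans_eq ?_
    simp only [sum_add_distrib, sum_const, nsmul_eq_mul, card_univ, hV, ← mul_sum, hSsum, miss]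
    ring
  have hn0 : (0 : ℝ) ≤ n := Nat.cast_nonneg _
  have : 2 * (n : ℝ) * #S ≤ 2 * n * (k * (κ * n + 1)) := by gcongr
  linarith

end Edits

/-- The Erdős–Simonovits **stability theorem** for complete equipartite graphs. -/
theorem exists_obtainedByEdits_turanGraph {k : ℕ} (hk : 2 ≤ k) {s : ℕ} (hs : 0 < s) {ε : ℝ}
    (hε : 0 < ε) :
    ∃ δ : ℝ, 0 < δ ∧ ∃ N : ℕ, ∀ (V : Type u) [Fintype V] (G : SimpleGraph V),
      N ≤ Fintype.card V → (completeEquipartiteGraph (k + 1) s).Free G →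
      (1 - 1 / (k : ℝ) - δ) * (Fintype.card V : ℝ) ^ 2 ≤ G.pairCount →
      G.ObtainedByEdits (turanGraph (Fintype.card V) k) (ε * (Fintype.card V : ℝ) ^ 2) := by
  obtain ⟨r, rfl⟩ : ∃ r, k = r + 1 := ⟨k - 1, by omega⟩
  obtain ⟨K, hK⟩ : ∃ K : ℝ, K = ((r + 1 : ℕ) : ℝ) := ⟨_, rfl⟩
  have hK0 : 0 < K := by rw [hK]; positivity
  -- The budget: `3ε/8` from inner and missing pairs, `ε/8` from imbalance, `ε/8` from rounding.
  set κ := ε / (16 * K)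
  have hκ : 0 < κ := by positivity
  have hKκ : K * κ = ε / 16 := by simp only [κ]; field_simp
  obtain ⟨η, hη⟩ : ∃ η, η = min (ε / 8) (κ ^ 2 / 2) := ⟨_, rfl⟩
  have hη0 : 0 < η := by rw [hη]; positivity
  have hη1 : η ≤ ε / 8 := hη ▸ min_le_left _ _
  have hη2 : η ≤ κ ^ 2 / 2 := hη ▸ min_le_right _ _
  obtain ⟨δ, hδ, N, hN⟩ := exists_partition_few_inner.{u} (r := r) (by omega) hs hη0
  obtain ⟨N', hN'⟩ := exists_nat_ge (16 * K / ε)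
  rw [div_le_iff₀ hε] at hN'
  refine ⟨min δ η, by positivity, max N N', fun V _ G hV hG hD ↦ ?_⟩
  have hδη := min_le_right δ η
  obtain ⟨p, hp⟩ := hN V G (le_of_max_le_left hV) hG
    (hD.trans' (by gcongr; exact min_le_left _ _))
  obtain ⟨H', hH', hcard⟩ := obtainedByEdits_turanGraph_of_partition (by omega) rfl G p hκ.le
    (by linarith) hD hp
  refine ⟨H', hH', hcard.trans ?_⟩
  rw [← hK]
  have hn : (N' : ℝ) ≤ Fintype.card V := by exact_mod_cast le_of_max_le_right hV
  set n : ℝ := (Fintype.card V : ℝ)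
  have hn0 : 0 ≤ n := by simp only [n]; positivity
  have h1 : (min δ η + 2 * η) * n ^ 2 ≤ (3 * ε / 8) * n ^ 2 := by
    gcongr; linarith
  have h2 : 16 * K * n ≤ n * ε * n :=
    mul_le_mul_of_nonneg_right (hN'.trans (by gcongr)) hn0
  have h3 : 2 * n * (K * (κ * n + 1)) = 2 * (K * κ) * n ^ 2 + 2 * K * n := by ring
  rw [h3, hKκ]
  have h4 : 0 ≤ ε * n ^ 2 := by positivity
  linarith

end SimpleGraph


theorem theorem2p11 (k : ℕ) (hk : 3 ≤ k)
    {W : Type*} [Finite W] (F : SimpleGraph W) (hF : F.chromaticNumber = ((k + 1 : ℕ) : ℕ∞))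
    (ε : ℝ) (hε : 0 < ε) :
    ∃ σ : ℝ, 0 < σ ∧ ∃ n₀ : ℕ,
      ∀ (V : Type*) [Fintype V] [DecidableEq V] (G : SimpleGraph V) [DecidableRel G.Adj] (n : ℕ),
        Fintype.card V = n → n₀ ≤ n → F.Free G →
        2 * (1 - 1 / (k : ℝ) - σ) * (n : ℝ) ≤ G.qIndex →
        G.ObtainedByEdits (SimpleGraph.turanGraph n k) (ε * (n : ℝ) ^ 2) := by
  classical
  have := Fintype.ofFinite W
  obtain ⟨C⟩ := SimpleGraph.chromaticNumber_le_iff_colorable.mp hF.le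
  -- Parts of this size hold any colour class; the extra 1 keeps `s` positive when `W` might be
  -- empty.
  set s := Fintype.card W + 1
  have hFK : F.IsContained (SimpleGraph.completeEquipartiteGraph (k + 1) s) := by
    refine SimpleGraph.isContained_completeEquipartiteGraph_of_colorable C s fun c ↦ ?_
    exact (Fintype.card_subtype_le _).trans (Nat.le_succ _)
  obtain ⟨δ, hδ, N₁, hN₁⟩ := SimpleGraph.exists_obtainedByEdits_turanGraph (k := k) (by omega)
    (Nat.succ_pos _ : 0 < s) hε
  have hbound : SimpleGraph.HasDensityBound (SimpleGraph.completeEquipartiteGraph (k + 1) s)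
      (1 - 1 / (k : ℝ)) :=
    fun ε' hε' ↦ SimpleGraph.exists_pairCount_le_sq_of_free hε' (by omega) s
  have hk' : 1 / (k : ℝ) ≤ 1 / 3 := by
    apply one_div_le_one_div_of_le (by norm_num)
    exact_mod_cast hk
  have hk0 : 0 < 1 / (k : ℝ) := by positivity
  obtain ⟨σ, hσ, N₂, hN₂⟩ := hbound.exists_le_pairCount (by linarith) (by linarith) hδ
  -- Halving `σ` matches `2(c - σ/2) = 2c - σ`; the 1 guarantees a vertex, so that `qIndex` is an
  -- attained eigenvalue.
  refine ⟨σ / 2, by positivity, max 1 (max N₁ N₂), fun V _ _ G _ n hV hn hG hq ↦ ?_⟩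
  subst hV
  have : Nonempty V := Fintype.card_pos_iff.mp (le_of_max_le_left hn)
  have hfree : (SimpleGraph.completeEquipartiteGraph (k + 1) s).Free G := fun h ↦ hG (hFK.trans h)
  refine hN₁ V G (le_of_max_le_left (le_of_max_le_right hn)) hfree
    (hN₂ V G (le_of_max_le_right (le_of_max_le_right hn)) hfree ?_)
  refine G.isQLower_qIndex.mono (le_trans (le_of_eq ?_) hq)
  ring
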